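/- Let $M,N\ge 1$ be integers, $\nu\in\mathbb R$, let $\boldsymbol\zeta_1,\dots,\boldsymbol\zeta_N$ be unit vectors of the Euclidean space $\mathbb R^M$, and let $\mathbf r_s=r_s\boldsymbol\zeta_s$ with $r_s\ge 0$ and $r_N>0$. Write $$l=\tfrac12\sum_{p=1}^N l_p,\qquad S_M=\frac{2\pi^{M/2}}{\Gamma(M/2)},\qquad (a)_0=1,\quad (a)_k=a(a+1)\cdots(a+k-1)\ \ (k=1,2,\dots),$$ let $d\Omega_{\boldsymbol\zeta}$ be the surface measure of the unit sphere of $\mathbb R^M$ (the counting measure on $\{1,-1\}$ if $M=1$), let $C_k^{\alpha}$ be the Gegenbauer polynomials, and put $$V_{l_1,\dots,l_N}(\boldsymbol\zeta_1,\dots,\boldsymbol\zeta_N)=\int\frac{d\Omega_{\boldsymbol\zeta}}{S_M}\prod_{i=1}^N\frac{l_i+\frac M2-1}{\frac M2-1}\,C_{l_i}^{\frac M2-1}\big(\boldsymbol\zeta_i\cdot\boldsymbol\zeta\big),$$ where for $M=2$ the factor $\frac{k+M/2-1}{M/2-1}C_k^{M/2-1}(z)$ is read as the limit of $\frac{k+\alpha}{\alpha}C_k^{\alpha}(z)$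 for $\alpha\to0$ (that is, $1$ for $k=0$ and $2T_k(z)$ for $k\ge 1$, with $T_k$ the Chebyshev polynomials of the first kind). Assume that $$\sum_{p=1}^{N-1}\frac{r_p}{r_N}<1$$ (so that, in particular, $r_N=\max(r_1,\dots,r_N)$). Then the following hold. (1) The multiple series below converges absolutely, and $$\frac1{|\mathbf r_1+\dots+\mathbf r_N|^{\nu}}=\frac1{r_N^{\nu}}\sum_{l_1,\dots,l_N=0}^\infty(-1)^{l_N}V_{l_1,\dots,l_N}(\boldsymbol\zeta_1,\dots,\boldsymbol\zeta_N)\sum_{\mu_1,\dots,\mu_{N-1}=0}^\infty\frac{\left(\frac\nu2\right)_{\mu_1+\dots+\mu_{N-1}+l}\left(\frac{\nu-M+2}2\right)_{\mu_1+\dots+\mu_{N-1}+l-l_N}}{\prod_{p=1}^{N-1}\left[\left(\frac M2\right)_{l_p+\mu_p}\mu_p!\right]}\prod_{p=1}^{N-1}\left(\frac{r_p}{r_N}\right)^{l_p+2\mu_p}.$$ Here $V_{l_1,\dots,l_N}(\boldsymbol\zeta_1,\dots,\boldsymbol\zeta_N)\ne0$ only if $l_1+\dots+l_N$ is even and $l_N\le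 l$, so that in all nonzero terms $l$ and $l-l_N$ are natural numbers; terms with $V_{l_1,\dots,l_N}(\boldsymbol\zeta_1,\dots,\boldsymbol\zeta_N)=0$ are understood to be $0$. (2) If for every $k\ge 0$ the functions $Y_{k,\mathbf m}$ form an orthonormal basis, with respect to $d\Omega_{\boldsymbol\zeta}$, of the space of complex hyperspherical harmonics of degree $k$ (the restrictions to the unit sphere of the homogeneous harmonic polynomials of degree $k$), then $$V_{l_1,\dots,l_N}(\boldsymbol\zeta_1,\dots,\boldsymbol\zeta_N)=(S_M)^{N-1}\sum_{\mathbf m^{(1)},\dots,\mathbf m^{(N)}}\ \prod_{p=1}^NY_{l_p,\mathbf m^{(p)}}(\boldsymbol\zeta_p)\int d\Omega_{\boldsymbol\zeta}\prod_{p=1}^N\overline{Y_{l_p,\mathbf m^{(p)}}(\boldsymbol\zeta)}\,.$$ (3) With the Lauricella function $$F_C^{(n)}\left[\begin{matrix}a,\ b\\ c_1,\dots,c_n\end{matrix}\,\Big|\,x_1,\dots,x_n\right]=\sum_{\mu_1,\dots,\mu_n=0}^\infty\frac{(a)_{\mu_1+\dots+\mu_n}(b)_{\mu_1+\dots+\mu_n}}{\prod_{p=1}^n(c_p)_{\mu_p}\,\mu_p!}\prod_{p=1}^nx_p^{\mu_p}$$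 one has $$\frac1{|\mathbf r_1+\dots+\mathbf r_N|^{\nu}}=\sum_{l_1,\dots,l_N=0}^\infty V_{l_1,\dots,l_N}(\boldsymbol\zeta_1,\dots,\boldsymbol\zeta_N)\,R_{l_1,\dots,l_N}(r_1,\dots,r_N),$$ $$R_{l_1,\dots,l_N}(r_1,\dots,r_N)=\frac{(-1)^{l_N}}{r_N^\nu}\,\frac{\left(\frac\nu2\right)_l\left(\frac{\nu-M+2}2\right)_{l-l_N}}{\prod_{p=1}^{N-1}\left(\frac M2\right)_{l_p}}\prod_{p=1}^{N-1}\left(\frac{r_p}{r_N}\right)^{l_p}F_C^{(N-1)}\left[\begin{matrix}l+\frac\nu2,\ \frac{\nu-M+2}2+l-l_N\\ l_1+\frac M2,\dots,l_{N-1}+\frac M2\end{matrix}\,\Big|\,\Big(\frac{r_1}{r_N}\Big)^2,\dots,\Big(\frac{r_{N-1}}{r_N}\Big)^2\right],$$ where the series over $l_1,\dots,l_N$ and all the Lauricella series converge absolutely (again terms with $V_{l_1,\dots,l_N}(\boldsymbol\zeta_1,\dots,\boldsymbol\zeta_N)=0$ are understood to be $0$). -/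

import Mathlib

noncomputable section

namespace Hyperspherical

/-- `M`-dimensional Euclidean space. -/
abbrev Euc (M : ℕ) : Type := EuclideanSpace ℝ (Fin M)

/-- The unit sphere of `M`-dimensional Euclidean space, i.e. the set of unit vectors. -/
abbrev USphere (M : ℕ) : Type := Metric.sphere (0 : Euc M) 1

/-- The surface measure on the unit sphere (total mass `2 π^(M/2) / Γ(M/2)` for `1 ≤ M`;
counting measure on the two points `1, -1` when `M = 1`). -/
def surf (M : ℕ) : MeasureTheory.Measure (USphere M) :=
  (MeasureTheory.volume : MeasureTheory.Measure (Euc M)).toSphere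

/-- The area of the unit sphere of `M`-dimensional Euclidean space. -/
def sphereArea (M : ℕ) : ℝ := 2 * Real.pi ^ ((M : ℝ) / 2) / Real.Gamma ((M : ℝ) / 2)

/-- The Pochhammer symbol `(a)_k = a (a + 1) ⋯ (a + k - 1)`, with natural index `k`. -/
def poch (a : ℝ) (k : ℕ) : ℝ := (ascPochhammer ℝ k).eval a

/-- The Pochhammer symbol `(a)_x` with real index `x`: the product `a (a + 1) ⋯ (a + x - 1)` when
`x` is a natural number, and `Γ(a + x) / Γ(a)` otherwise. -/
def pochReal (a x : ℝ) : ℝ :=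
  open Classical in
  if x = (⌊x⌋₊ : ℝ) then poch a ⌊x⌋₊ else Real.Gamma (a + x) / Real.Gamma a

/-- The Gegenbauer polynomial `C_l^α(z)`. -/
def gegenbauer (α : ℝ) (l : ℕ) (z : ℝ) : ℝ :=
  ∑ k ∈ Finset.range (l / 2 + 1),
    (-1) ^ k * poch α (l - k) / ((k.factorial : ℝ) * ((l - 2 * k).factorial : ℝ)) *
      (2 * z) ^ (l - 2 * k)

/-- The normalized Gegenbauer polynomial `(l + M/2 - 1) / (M/2 - 1) * C_l^{M/2 - 1}(z)`.
For `M = 2` it is, as usual, the limit of `(l + α) / α * C_l^α(z)` as `α → 0`, namely `1` for `l = 0`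
and `2 T_l(z)` for `l ≥ 1`, with `T_l` the Chebyshev polynomial of the first kind. -/
def normGegenbauer (M l : ℕ) (z : ℝ) : ℝ :=
  if M = 2 then
    (if l = 0 then 1 else 2 * (Polynomial.Chebyshev.T ℝ (l : ℤ)).eval z)
  else
    ((l : ℝ) + (M : ℝ) / 2 - 1) / ((M : ℝ) / 2 - 1) * gegenbauer ((M : ℝ) / 2 - 1) l z

/-- The angular function `V_{l_1, …, l_N}(ζ_1, …, ζ_N)`: the sphere average of the product of the
normalized Gegenbauer polynomials of the scalar products `ζ_i · ζ`. -/
def angV {M N : ℕ} (l : Fin N → ℕ) (ζ : Fin N → USphere M) : ℝ :=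
  (∫ ω : USphere M, ∏ i, normGegenbauer M (l i) (inner ℝ (ζ i : Euc M) (ω : Euc M)) ∂(surf M)) /
    sphereArea M

/-- `f` is a (complex) hyperspherical harmonic of degree `l`: the restriction to the unit sphere of
a homogeneous harmonic polynomial of degree `l`. -/
def IsSphericalHarmonic (M l : ℕ) (f : USphere M → ℂ) : Prop :=
  ∃ p : MvPolynomial (Fin M) ℂ, p.IsHomogeneous l ∧
    ∑ i, MvPolynomial.pderiv i (MvPolynomial.pderiv i p) = 0 ∧
    ∀ ω : USphere M, f ω = MvPolynomial.eval (fun i => (((ω : Euc M) i : ℝ) : ℂ)) p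

/-- `Y` enumerates the hyperspherical functions of degree `l` for some choice of coordinates:
an orthonormal basis, with respect to surface measure, of the hyperspherical harmonics of
degree `l`. -/
structure IsHarmonicBasis (M l : ℕ) {d : ℕ} (Y : Fin d → USphere M → ℂ) : Prop where
  mem : ∀ m, IsSphericalHarmonic M l (Y m)
  orthonormal : ∀ m m', ∫ ω, Y m ω * (starRingEnd ℂ) (Y m' ω) ∂(surf M) = if m = m' then 1 else 0
  span : ∀ f, IsSphericalHarmonic M l f → f ∈ Submodule.span ℂ (Set.range Y)

/-- The general term of the Lauricella series `F_C^{(n)}[a, b; c_1, …, c_n | x_1, …, x_n]`. -/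
def lauricellaTerm {n : ℕ} (a b : ℝ) (c x : Fin n → ℝ) (μ : Fin n → ℕ) : ℝ :=
  poch a (∑ p, μ p) * poch b (∑ p, μ p) /
      (∏ p, (poch (c p) (μ p) * ((μ p).factorial : ℝ))) * ∏ p, x p ^ μ p

/-- The Lauricella function `F_C^{(n)}`, as the sum of its series. -/
def lauricellaFC {n : ℕ} (a b : ℝ) (c x : Fin n → ℝ) : ℝ :=
  ∑' μ : Fin n → ℕ, lauricellaTerm a b c x μ

/-- Half of the sum of the indices, `(l_1 + ⋯ + l_N) / 2`. -/
def halfSum {N : ℕ} (l : Fin N → ℕ) : ℝ := (∑ p, (l p : ℝ)) / 2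

/-- The term of index `(l, μ)`, with `l = (l_1, …, l_N)` and `μ = (μ_1, …, μ_{N-1})`, `N = n + 1`,
of the power series in the ratios `r_p / r_N`. -/
def seriesTerm {M n : ℕ} (ν : ℝ) (r : Fin (n + 1) → ℝ) (ζ : Fin (n + 1) → USphere M)
    (l : Fin (n + 1) → ℕ) (μ : Fin n → ℕ) : ℝ :=
  (-1) ^ l (Fin.last n) * angV l ζ *
    (pochReal (ν / 2) ((∑ p, (μ p : ℝ)) + halfSum l) *
        pochReal ((ν - M + 2) / 2) ((∑ p, (μ p : ℝ)) + halfSum l - l (Fin.last n)) /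
      ∏ p : Fin n, (poch ((M : ℝ) / 2) (l p.castSucc + μ p) * ((μ p).factorial : ℝ))) *
    ∏ p : Fin n, (r p.castSucc / r (Fin.last n)) ^ (l p.castSucc + 2 * μ p)

/-- First numerator parameter of the Lauricella function of index `l`. -/
def paramA {n : ℕ} (ν : ℝ) (l : Fin (n + 1) → ℕ) : ℝ := halfSum l + ν / 2

/-- Second numerator parameter of the Lauricella function of index `l`. -/
def paramB {n : ℕ} (M : ℕ) (ν : ℝ) (l : Fin (n + 1) → ℕ) : ℝ :=
  (ν - M + 2) / 2 + halfSum l - l (Fin.last n)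

/-- Denominator parameters of the Lauricella function of index `l`. -/
def paramC {n : ℕ} (M : ℕ) (l : Fin (n + 1) → ℕ) (p : Fin n) : ℝ :=
  (l p.castSucc : ℝ) + (M : ℝ) / 2

/-- Arguments `(r_p / r_N)^2` of the Lauricella functions. -/
def argX {n : ℕ} (r : Fin (n + 1) → ℝ) (p : Fin n) : ℝ :=
  (r p.castSucc / r (Fin.last n)) ^ 2

/-- The radial function `R_{l_1, …, l_N}(r_1, …, r_N)`, written with a Lauricella function `F_C`. -/
def radialR {n : ℕ} (M : ℕ) (ν : ℝ) (r : Fin (n + 1) → ℝ) (l : Fin (n + 1) → ℕ) : ℝ :=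
  (-1) ^ l (Fin.last n) * r (Fin.last n) ^ (-ν) *
    (pochReal (ν / 2) (halfSum l) *
        pochReal ((ν - M + 2) / 2) (halfSum l - l (Fin.last n)) /
      ∏ p : Fin n, poch ((M : ℝ) / 2) (l p.castSucc)) *
    (∏ p : Fin n, (r p.castSucc / r (Fin.last n)) ^ l p.castSucc) *
    lauricellaFC (paramA ν l) (paramB M ν l) (paramC M l) (argX r)

end Hyperspherical

end

/-! Factor out `r_N`: the vector is `r_N (ζ_N + y)` with `y = ∑ (r_p / r_N) ζ_p = ρ η`, `η` a unit
vector and `ρ < 1`. With `t = ζ_N · η` and `λ = ν / 2`, the Gegenbauer generating function gives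
`|ζ_N + ρ η|^(-ν) = (1 + 2 t ρ + ρ^2)^(-λ) = ∑_m C_m^λ(-t) ρ^m` (`hasSum_gegenExp`). The connection
formula rewrites `C_m^λ` through the zonal polynomials `Z_L` of parameter `α = M/2 - 1`, with `m = L
+ 2k` and coefficients `(λ)_{L+k} (λ-α)_k / ((M/2)_{L+k} k!)`.

The vectors `ζ_1, …, ζ_{N-1}` are separated by computing the sphere integral of `(y · ω)^m Z_L(ζ_N ·
ω)` in two ways (`sum_termWeight_mul_angV`). A Funk–Hecke type formula for harmonic polynomials
(`sphInt_harmonic_mul_linForm_pow`) turns it into a constant times `ρ^m Z_L(t)`. The multinomial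
theorem, with each power of `ζ_p · ω` expanded in zonal polynomials, turns it into a weighted sum of
the functions `V`. Hence, for fixed `L = l_N` and total degree `m = ∑ (l_p + 2 μ_p)`, the terms of
the multiple series add up to one term of the connection formula (`sum_degreeSet_seriesTerm`), and
regrouping by `m` proves the first expansion. Regrouping is legitimate because, up to subexponential
factors and a geometric factor in `L`, each term is dominated by a product of two terms of
multinomial series in the ratios `r_p / r_N`, whose sum is less than `1` (`abs_seriesTerm_snoc_le`).

The harmonic analysis rests on one identity: for a homogeneous `p` of degree `d`, the sphere
integral of `Δp` is `d (d + M - 2)` times that of `p` (`sphInt_lap`). It yields orthogonality, the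
Funk–Hecke type formula, the reproducing property of zonal harmonics, the bound `|Z_l| ≤ Z_l(1)`,
the selection rule for `V` and the addition theorem. The Lauricella form comes from `(a)_{i+j} =
(a)_i (a+i)_j` and summation over `μ` first. -/

open MeasureTheory MvPolynomial Filter Topology

namespace Hyperspherical

noncomputable section

variable {M : ℕ}

/-! ### Gaussian moments and integration of polynomials over the sphere -/

/-- The one-dimensional Gaussian moment of order `k`. -/
def gaussMoment (k : ℕ) : ℝ := ∫ t : ℝ, t ^ k * Real.exp (-t ^ 2)

lemma integrable_pow_mul_gaussian (k : ℕ) :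
    Integrable fun t : ℝ => t ^ k * Real.exp (-t ^ 2) := by
  have := integrable_rpow_mul_exp_neg_mul_sq (b := 1) one_pos (s := k)
    (by have := k.cast_nonneg (α := ℝ); linarith)
  simpa [Real.rpow_natCast] using this

lemma gaussMoment_odd {k : ℕ} (hk : Odd k) : gaussMoment k = 0 := by
  have h := integral_neg_eq_self (fun t : ℝ => t ^ k * Real.exp (-t ^ 2)) volume
  simp only [hk.neg_pow, neg_sq, neg_mul, integral_neg] at h
  unfold gaussMoment
  linarith

lemma gaussMoment_add_two (k : ℕ) : 2 * gaussMoment (k + 2) = (k + 1) * gaussMoment k := by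
  have h := integral_mul_deriv_eq_deriv_mul_of_integrable
    (u := fun t : ℝ => t ^ (k + 1)) (v := fun t : ℝ => Real.exp (-t ^ 2))
    (u' := fun t : ℝ => ((k : ℝ) + 1) * t ^ k) (v' := fun t : ℝ => Real.exp (-t ^ 2) * (-(2 * t)))
    (fun t _ => by simpa using hasDerivAt_pow (k + 1) t)
    (fun t _ => by
      have h2 : HasDerivAt (fun t : ℝ => -t ^ 2) (-(2 * t)) t := by
        simpa using (hasDerivAt_pow 2 t).fun_neg
      exact h2.exp)
    (by
      refine ((integrable_pow_mul_gaussian (k + 2)).const_mul (-2)).congr (.of_forall fun t => ?_)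
      simp only [Pi.mul_apply]; ring)
    (by
      refine ((integrable_pow_mul_gaussian k).const_mul (k + 1)).congr (.of_forall fun t => ?_)
      simp only [Pi.mul_apply]; ring)
    (by
      refine (integrable_pow_mul_gaussian (k + 1)).congr (.of_forall fun t => ?_)
      simp only [Pi.mul_apply])
  have e1 : ∫ t : ℝ, t ^ (k + 1) * (Real.exp (-t ^ 2) * (-(2 * t))) = -2 * gaussMoment (k + 2) := by
    rw [gaussMoment, ← integral_const_mul]
    congr 1; ext t; ring
  have e2 : ∫ t : ℝ, ((k : ℝ) + 1) * t ^ k * Real.exp (-t ^ 2) = (k + 1) * gaussMoment k := by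
    rw [gaussMoment, ← integral_const_mul]
    congr 1; ext t; ring
  rw [e1, e2] at h
  linarith

/-- The radial Gaussian moment of order `s`. -/
def radialMoment (s : ℕ) : ℝ := ∫ r in Set.Ioi (0 : ℝ), r ^ s * Real.exp (-r ^ 2)

lemma radialMoment_eq (s : ℕ) : radialMoment s = Real.Gamma (((s : ℝ) + 1) / 2) / 2 := by
  have := integral_rpow_mul_exp_neg_rpow (p := 2) (q := s) two_pos
    (by have := s.cast_nonneg (α := ℝ); linarith)
  simp only [Real.rpow_natCast, Real.rpow_two] at this
  rw [radialMoment, this]; ring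

lemma radialMoment_pos (s : ℕ) : 0 < radialMoment s := by
  rw [radialMoment_eq]
  exact div_pos (Real.Gamma_pos_of_pos (by positivity)) two_pos

lemma radialMoment_add_two (s : ℕ) : 2 * radialMoment (s + 2) = (s + 1) * radialMoment s := by
  rw [radialMoment_eq, radialMoment_eq,
    show (((s + 2 : ℕ) : ℝ) + 1) / 2 = ((s : ℝ) + 1) / 2 + 1 by push_cast; ring,
    Real.Gamma_add_one (by positivity)]
  ring

/-- The value of a complex polynomial at a point of Euclidean space. -/
def evalAt {M : ℕ} (x : Euc M) (p : MvPolynomial (Fin M) ℂ) : ℂ :=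
  eval (fun i => ((x i : ℝ) : ℂ)) p

lemma evalAt_smul {M d : ℕ} {p : MvPolynomial (Fin M) ℂ} (hp : p.IsHomogeneous d)
    (a : ℝ) (x : Euc M) : evalAt (a • x) p = (a : ℂ) ^ d * evalAt x p := by
  unfold evalAt
  rw [eval_eq', eval_eq', Finset.mul_sum]
  refine Finset.sum_congr rfl fun s hs => ?_
  have hd : ∑ i, s i = d := by
    rw [← hp (mem_support_iff.1 hs), Finsupp.weight_apply, Finsupp.sum_fintype _ _ (by simp)]
    simp
  simp only [PiLp.smul_apply, smul_eq_mul, Complex.ofReal_mul, mul_pow, Finset.prod_mul_distrib,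
    Finset.prod_pow_eq_pow_sum, hd]
  ring

lemma continuous_evalAt {M : ℕ} (p : MvPolynomial (Fin M) ℂ) :
    Continuous fun x : Euc M => evalAt x p := by
  unfold evalAt
  exact (MvPolynomial.continuous_eval p).comp (by fun_prop)

/-- Polar coordinates: homogeneity splits off `r ^ d`, and the Jacobian contributes `r ^ (M - 1)`.
Sphere integrals of monomials thereby reduce to one-dimensional Gaussian moments. -/
lemma integral_homogeneous_mul_gaussian {M d : ℕ} (hM : 1 ≤ M) {f : Euc M → ℂ}
    (hf : ∀ (a : ℝ) (x : Euc M), f (a • x) = (a : ℂ) ^ d * f x) :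
    ∫ x : Euc M, f x * Real.exp (-‖x‖ ^ 2) =
      (∫ ω : USphere M, f ω ∂(surf M)) * radialMoment (d + (M - 1)) := by
  have : Nontrivial (Euc M) := by
    have : Nonempty (Fin M) := ⟨⟨0, hM⟩⟩
    infer_instance
  have hdim : Module.finrank ℝ (Euc M) = M := by simp
  have h1 : ∫ x : Euc M, f x * Real.exp (-‖x‖ ^ 2) =
      ∫ x : ({(0 : Euc M)}ᶜ : Set (Euc M)), f x * Real.exp (-‖(x : Euc M)‖ ^ 2)
        ∂((volume : Measure (Euc M)).comap (↑)) := by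
    rw [integral_subtype_comap (measurableSet_singleton _).compl
      fun x : Euc M => f x * Real.exp (-‖x‖ ^ 2), MeasureTheory.restrict_compl_singleton]
  have h2 := (volume : Measure (Euc M)).measurePreserving_homeomorphUnitSphereProd.integral_comp
    (Homeomorph.measurableEmbedding _)
    (fun q : USphere M × Set.Ioi (0 : ℝ) => f (q.1 : Euc M) *
      ((((q.2 : ℝ) : ℂ) ^ d * Real.exp (-(q.2 : ℝ) ^ 2) : ℂ)))
  rw [h1]
  have h3 : ∀ x : ({(0 : Euc M)}ᶜ : Set (Euc M)), f x * Real.exp (-‖(x : Euc M)‖ ^ 2) =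
      f ((homeomorphUnitSphereProd (Euc M) x).1 : Euc M) *
        (((((homeomorphUnitSphereProd (Euc M) x).2 : ℝ) : ℂ)) ^ d *
          Real.exp (-((homeomorphUnitSphereProd (Euc M) x).2 : ℝ) ^ 2)) := by
    intro x
    have hx : (x : Euc M) ≠ 0 := x.2
    have : f x = f (‖(x : Euc M)‖ • (‖(x : Euc M)‖⁻¹ • (x : Euc M))) := by
      rw [smul_smul, mul_inv_cancel₀ (norm_ne_zero_iff.2 hx), one_smul]
    rw [this, hf]
    simp
    ring
  simp_rw [h3]
  rw [h2, integral_prod_mul (fun ω : USphere M => f ω)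
    (fun r : Set.Ioi (0 : ℝ) => (((r : ℝ) : ℂ) ^ d * Real.exp (-(r : ℝ) ^ 2) : ℂ))]
  congr 1
  rw [hdim, radialMoment, ← integral_complex_ofReal]
  simp only [Measure.volumeIoiPow, ENNReal.ofReal]
  rw [integral_withDensity_eq_integral_smul
      ((measurable_subtype_coe.pow_const _).real_toNNReal),
    integral_subtype_comap measurableSet_Ioi fun a : ℝ =>
      Real.toNNReal (a ^ (M - 1)) • ((a : ℂ) ^ d * (Real.exp (-a ^ 2) : ℂ))]
  refine setIntegral_congr_fun measurableSet_Ioi fun x hx => ?_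
  rw [NNReal.smul_def, Real.coe_toNNReal _ (pow_nonneg (le_of_lt hx) _), Complex.real_smul]
  push_cast; ring

instance isFiniteMeasure_surf (M : ℕ) : IsFiniteMeasure (surf M) := by
  unfold surf; infer_instance

lemma integrable_sphere {M : ℕ} {E : Type*} [NormedAddCommGroup E] [SecondCountableTopology E]
    {f : USphere M → E} (hf : Continuous f) : Integrable f (surf M) :=
  hf.integrable_of_hasCompactSupport (HasCompactSupport.of_compactSpace f)

/-- The integral of a polynomial over the unit sphere, as a linear functional. -/
def sphInt (M : ℕ) : MvPolynomial (Fin M) ℂ →ₗ[ℂ] ℂ where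
  toFun p := ∫ ω : USphere M, evalAt (ω : Euc M) p ∂(surf M)
  map_add' p q := by
    have h (p : MvPolynomial (Fin M) ℂ) :
        Integrable (fun ω : USphere M => evalAt (ω : Euc M) p) (surf M) :=
      integrable_sphere ((continuous_evalAt p).comp continuous_subtype_val)
    rw [← integral_add (h p) (h q)]
    simp only [evalAt, map_add]
  map_smul' a p := by
    simp only [evalAt, smul_eval, integral_const_mul]; rfl

lemma sphInt_apply {M : ℕ} (p : MvPolynomial (Fin M) ℂ) :
    sphInt M p = ∫ ω : USphere M, evalAt (ω : Euc M) p ∂(surf M) := rfl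

lemma integral_euc_prod {M : ℕ} (g : Fin M → ℝ → ℂ) :
    ∫ x : Euc M, ∏ i, g i (x i) = ∏ i, ∫ t, g i t := by
  rw [← integral_fintype_prod_volume_eq_prod]
  exact (EuclideanSpace.volume_preserving_symm_measurableEquiv_toLp (Fin M)).integral_comp
    (MeasurableEquiv.measurableEmbedding _) (fun x : Fin M → ℝ => ∏ i, g i (x i))

lemma sphInt_monomial {M : ℕ} (hM : 1 ≤ M) (s : Fin M →₀ ℕ) :
    sphInt M (monomial s 1) * radialMoment (∑ i, s i + (M - 1)) =
      ∏ i, (gaussMoment (s i) : ℂ) := by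
  have hhom : (monomial s (1 : ℂ)).IsHomogeneous (∑ i, s i) := by
    refine isHomogeneous_monomial _ ?_
    rw [Finsupp.degree_eq_sum]
  rw [sphInt_apply, ← integral_homogeneous_mul_gaussian (f := fun x => evalAt x (monomial s 1)) hM
    (fun a x => evalAt_smul hhom a x)]
  have : ∀ x : Euc M, evalAt x (monomial s 1) * (Real.exp (-‖x‖ ^ 2) : ℂ) =
      ∏ i, ((x i : ℂ) ^ s i * (Real.exp (-(x i) ^ 2) : ℂ)) := by
    intro x
    rw [evalAt, eval_monomial, one_mul, Finset.prod_mul_distrib, ← Complex.ofReal_prod,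
      ← Real.exp_sum, EuclideanSpace.real_norm_sq_eq, Finsupp.prod_fintype _ _ (by simp),
      Finset.sum_neg_distrib]
  simp_rw [this]
  rw [integral_euc_prod (fun i t => (t : ℂ) ^ s i * (Real.exp (-t ^ 2) : ℂ))]
  refine Finset.prod_congr rfl fun i _ => ?_
  rw [gaussMoment, ← integral_complex_ofReal]
  simp

lemma IsHomogeneous.sum_eq {M d : ℕ} {p : MvPolynomial (Fin M) ℂ} (hp : p.IsHomogeneous d)
    {s : Fin M →₀ ℕ} (hs : s ∈ p.support) : ∑ i, s i = d := by
  rw [← hp (mem_support_iff.1 hs), Finsupp.weight_apply, Finsupp.sum_fintype _ _ (by simp)]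
  simp

lemma sphInt_odd {M : ℕ} (hM : 1 ≤ M) {d : ℕ} (hd : Odd d) {p : MvPolynomial (Fin M) ℂ}
    (hp : p.IsHomogeneous d) : sphInt M p = 0 := by
  rw [p.as_sum, map_sum]
  refine Finset.sum_eq_zero fun s hs => ?_
  have hsum := IsHomogeneous.sum_eq hp hs
  obtain ⟨i, hi⟩ : ∃ i, Odd (s i) := by
    by_contra! h
    rw [← hsum] at hd
    exact (Nat.not_even_iff_odd.2 hd) (Finset.even_sum _ fun i _ => Nat.not_odd_iff_even.1 (h i))
  have h := sphInt_monomial hM s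
  rw [Finset.prod_eq_zero (Finset.mem_univ i) (by simp [gaussMoment_odd hi]), mul_eq_zero,
    or_iff_left (by exact_mod_cast (radialMoment_pos _).ne')] at h
  rw [← mul_one (coeff s p), ← smul_eq_mul (coeff s p), ← smul_monomial, map_smul, h, smul_zero]

/-! ### The Laplacian under the sphere integral -/

/-- The Laplacian on polynomials. -/
def lap {M : ℕ} : MvPolynomial (Fin M) ℂ →ₗ[ℂ] MvPolynomial (Fin M) ℂ :=
  ∑ i, (pderiv i).toLinearMap ∘ₗ (pderiv i).toLinearMap

lemma lap_apply {M : ℕ} (p : MvPolynomial (Fin M) ℂ) : lap p = ∑ i, pderiv i (pderiv i p) := by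
  simp [lap]

/-- Integrating by parts in the Gaussian moments replaces Green's formula. The second derivative in
`x i` lowers one exponent by two, so the recurrences for `gaussMoment` and `radialMoment` give the
factor `s i * (d + M - 2)`; summing over `i` gives `d * (d + M - 2)`. -/
lemma sphInt_lap_monomial {M : ℕ} (hM : 1 ≤ M) (s : Fin M →₀ ℕ) :
    sphInt M (lap (monomial s 1)) =
      ((∑ i, s i : ℕ) : ℂ) * (((∑ i, s i : ℕ) : ℂ) + M - 2) * sphInt M (monomial s 1) := by
  set d := ∑ i, s i with hd
  have hhom : (monomial s (1 : ℂ)).IsHomogeneous d := by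
    refine isHomogeneous_monomial _ ?_
    rw [Finsupp.degree_eq_sum]
  have hterm : ∀ i, pderiv i (pderiv i (monomial s (1 : ℂ))) =
      ((s i : ℂ) * ((s i - 1 : ℕ) : ℂ)) •
        monomial (s - Finsupp.single i 1 - Finsupp.single i 1) (1 : ℂ) := by
    intro i
    simp [pderiv_monomial, smul_monomial]
  have key : ∀ i, sphInt M (pderiv i (pderiv i (monomial s (1 : ℂ)))) =
      s i * ((d : ℂ) + M - 2) * sphInt M (monomial s 1) := by
    intro i
    rw [hterm, map_smul, smul_eq_mul]
    -- For `s i < 2` the second derivative vanishes; the right side vanishes too, through the factor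
    -- `s i` or because an odd exponent makes the monomial integrate to zero.
    rcases Nat.lt_or_ge (s i) 2 with h2 | h2
    · interval_cases h : s i
      · simp
      · have h0 := sphInt_monomial hM s
        rw [Finset.prod_eq_zero (Finset.mem_univ i) (by simp [h, gaussMoment_odd odd_one]),
          mul_eq_zero, or_iff_left (by exact_mod_cast (radialMoment_pos _).ne')] at h0
        simp [h0]
    · obtain ⟨k, hk⟩ := Nat.exists_eq_add_of_le' h2
      obtain ⟨t, ht⟩ : ∃ t, s - Finsupp.single i 1 - Finsupp.single i 1 = t := ⟨_, rfl⟩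
      have hti : t i = k := by simp [← ht, hk]
      have htj : ∀ j ∈ Finset.univ.erase i, t j = s j := by
        intro j hj
        simp [← ht, (Finset.ne_of_mem_erase hj).symm]
      have hdt : d = ∑ j, t j + 2 := by
        rw [hd, ← Finset.add_sum_erase _ _ (Finset.mem_univ i),
          ← Finset.add_sum_erase _ _ (Finset.mem_univ i), hti, Finset.sum_congr rfl htj, hk]
        ring
      have h1 := sphInt_monomial hM s
      have h3 := sphInt_monomial hM t
      rw [← Finset.mul_prod_erase _ _ (Finset.mem_univ i)] at h1 h3
      rw [Finset.prod_congr rfl fun j hj => by rw [htj j hj], hti] at h3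
      rw [← hd, hdt, hk, show ∑ j, t j + 2 + (M - 1) = ∑ j, t j + (M - 1) + 2 by omega] at h1
      have hR := radialMoment_add_two (∑ j, t j + (M - 1))
      have hG := gaussMoment_add_two k
      have hR0 : (radialMoment (∑ j, t j + (M - 1)) : ℂ) ≠ 0 := by
        exact_mod_cast (radialMoment_pos _).ne'
      have hRc : 2 * (radialMoment (∑ j, t j + (M - 1) + 2) : ℂ) =
          ((d : ℂ) + M - 2) * radialMoment (∑ j, t j + (M - 1)) := by
        have := congrArg (fun x : ℝ => (x : ℂ)) hR
        push_cast [Nat.cast_sub hM] at this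
        rw [this, hdt]; push_cast; ring
      have hGc : 2 * (gaussMoment (k + 2) : ℂ) = ((k : ℂ) + 1) * gaussMoment k := by
        exact_mod_cast congrArg (fun x : ℝ => (x : ℂ)) hG
      rw [ht, hk]
      refine mul_right_cancel₀ hR0 ?_
      rw [mul_assoc, h3, show k + 2 - 1 = k + 1 by omega]
      push_cast
      linear_combination (-((k : ℂ) + 2) * ∏ j ∈ Finset.univ.erase i, (gaussMoment (s j) : ℂ)) * hGc
        + ((k : ℂ) + 2) * sphInt M (monomial s 1) * hRc - 2 * ((k : ℂ) + 2) * h1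
  rw [lap_apply, map_sum, Finset.sum_congr rfl fun i _ => key i, ← Finset.sum_mul,
    ← Finset.sum_mul, ← Nat.cast_sum]

lemma sphInt_lap {M : ℕ} (hM : 1 ≤ M) {d : ℕ} {p : MvPolynomial (Fin M) ℂ}
    (hp : p.IsHomogeneous d) :
    sphInt M (lap p) = (d : ℂ) * ((d : ℂ) + M - 2) * sphInt M p := by
  rw [p.as_sum, map_sum, map_sum, map_sum, Finset.mul_sum]
  refine Finset.sum_congr rfl fun s hs => ?_
  rw [← mul_one (coeff s p), ← smul_eq_mul (coeff s p), ← smul_monomial, map_smul, map_smul,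
    map_smul, sphInt_lap_monomial hM, IsHomogeneous.sum_eq hp hs]
  simp only [smul_eq_mul]
  ring

lemma surf_real_univ {M : ℕ} (hM : 1 ≤ M) : (surf M).real Set.univ = sphereArea M := by
  have : Nonempty (Fin M) := ⟨⟨0, hM⟩⟩
  rw [surf, Measure.toSphere_real_apply_univ, Measure.real, EuclideanSpace.volume_ball]
  have hM' : (0 : ℝ) < M := by exact_mod_cast hM
  have h1 : √Real.pi ^ M = Real.pi ^ ((M : ℝ) / 2) := by
    rw [Real.sqrt_eq_rpow, ← Real.rpow_natCast, ← Real.rpow_mul Real.pi_pos.le]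
    congr 1; ring
  have h2 : 0 < Real.Gamma ((M : ℝ) / 2) := Real.Gamma_pos_of_pos (by positivity)
  have h3 := Real.Gamma_add_one (s := (M : ℝ) / 2) (by positivity)
  simp only [ENNReal.ofReal_one, one_pow, one_mul, Fintype.card_fin, finrank_euclideanSpace]
  rw [ENNReal.toReal_ofReal (by rw [h3]; positivity), h3, h1, sphereArea]
  field_simp

lemma sphereArea_pos {M : ℕ} (hM : 1 ≤ M) : 0 < sphereArea M := by
  have : (0 : ℝ) < M := by exact_mod_cast hM
  exact div_pos (by positivity) (Real.Gamma_pos_of_pos (by positivity))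

lemma sphInt_C {M : ℕ} (hM : 1 ≤ M) (a : ℂ) : sphInt M (C a) = a * sphereArea M := by
  simp [sphInt_apply, evalAt, surf_real_univ hM, mul_comm]

/-! ### Pochhammer symbols and sums over `j + 2 k = m` -/

lemma poch_zero (a : ℝ) : poch a 0 = 1 := by simp [poch]

lemma poch_succ (a : ℝ) (n : ℕ) : poch a (n + 1) = poch a n * (a + n) := by
  simp [poch, ascPochhammer_succ_eval]

lemma poch_succ_left (a : ℝ) (n : ℕ) : poch a (n + 1) = a * poch (a + 1) n := by
  simp [poch, ascPochhammer_succ_left, Polynomial.eval_comp]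

lemma poch_pos {a : ℝ} (ha : 0 < a) (n : ℕ) : 0 < poch a n := ascPochhammer_pos n a ha

lemma poch_add (a : ℝ) (m n : ℕ) : poch a (m + n) = poch a m * poch (a + m) n := by
  induction n with
  | zero => simp [poch_zero]
  | succ n ih => rw [← add_assoc, poch_succ, ih, poch_succ]; push_cast; ring

/-- The sum of `f j k` over the pairs `(j, k)` with `j + 2 k = m`. -/
def parSum {A : Type*} [AddCommMonoid A] (m : ℕ) (f : ℕ → ℕ → A) : A :=
  ∑ k ∈ Finset.range (m / 2 + 1), f (m - 2 * k) k

section parSum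
variable {A : Type*} [AddCommMonoid A]

lemma parSum_zero (f : ℕ → ℕ → A) : parSum 0 f = f 0 0 := by simp [parSum]

lemma parSum_one (f : ℕ → ℕ → A) : parSum 1 f = f 1 0 := by simp [parSum]

lemma parSum_add_two (m : ℕ) (f : ℕ → ℕ → A) :
    parSum (m + 2) f = parSum m (fun j k => f j (k + 1)) + f (m + 2) 0 := by
  rw [parSum, show (m + 2) / 2 + 1 = m / 2 + 1 + 1 by omega, Finset.sum_range_succ', parSum]
  congr 1
  refine Finset.sum_congr rfl fun k _ => ?_
  congr 1; omega

lemma parSum_congr {m : ℕ} {f g : ℕ → ℕ → A} (h : ∀ j k, j + 2 * k = m → f j k = g j k) :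
    parSum m f = parSum m g := by
  refine Finset.sum_congr rfl fun k hk => h _ _ ?_
  have := Finset.mem_range.1 hk
  omega

lemma parSum_shift_left (m : ℕ) {f : ℕ → ℕ → A} (h : ∀ k, f 0 k = 0) :
    parSum (m + 1) f = parSum m (fun j k => f (j + 1) k) := by
  induction m using Nat.twoStepInduction generalizing f with
  | zero => simp [parSum_one, parSum_zero]
  | one => simp [parSum_add_two, parSum_one, parSum_zero, h]
  | more m ih _ => rw [parSum_add_two, ih (by simp [h]), parSum_add_two]

lemma parSum_shift_right (m : ℕ) {f : ℕ → ℕ → A} (h : ∀ j, f j 0 = 0) :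
    parSum (m + 2) f = parSum m (fun j k => f j (k + 1)) := by
  rw [parSum_add_two, h, add_zero]

lemma parSum_add (m : ℕ) (f g : ℕ → ℕ → A) :
    parSum m (fun j k => f j k + g j k) = parSum m f + parSum m g :=
  Finset.sum_add_distrib

lemma mul_parSum {R : Type*} [NonUnitalNonAssocSemiring R] (a : R) (m : ℕ) (f : ℕ → ℕ → R) :
    a * parSum m f = parSum m (fun j k => a * f j k) := Finset.mul_sum ..

end parSum

/-! ### Zonal polynomials, their recurrence and expansions in them -/

/-- The coefficient of `(2 t)^j` in the zonal polynomial of degree `j + 2 k`. -/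
def zonalCoeff (α : ℝ) (j k : ℕ) : ℝ :=
  -- The factor `α` of `(α)_{j+k}` cancels the denominator `α`, so nothing singular remains at `α =
  -- 0`. For `j + k = 0` there is no such factor, and the quotient `α / α` is set to `1`.
  if j + k = 0 then 1
  else (-1) ^ k * (j + 2 * k + α) * poch (α + 1) (j + k - 1) / (k.factorial * j.factorial)

/-- The zonal polynomial `(l + α) / α * C_l^α(t)`, extended to `α = 0` by continuity. -/
def zonal (α : ℝ) (l : ℕ) (t : ℝ) : ℝ := parSum l fun j k => zonalCoeff α j k * (2 * t) ^ j

/-- The coefficient of the lower-degree term in the three-term recurrence of zonal polynomials. -/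
def lowerCoeff (α : ℝ) (l : ℕ) : ℝ := if l = 0 then 1 else (l + 2 * α) / (2 * (l + α))

/-- The coefficient of the higher-degree term in the three-term recurrence. -/
def upperCoeff (α : ℝ) (l : ℕ) : ℝ := l / (2 * (l + α))

lemma zonal_zero (α t : ℝ) : zonal α 0 t = 1 := by simp [zonal, parSum_zero, zonalCoeff]

lemma zonal_one (α t : ℝ) : zonal α 1 t = 2 * (1 + α) * t := by
  simp [zonal, parSum_one, zonalCoeff, poch_zero]; ring

lemma natCast_add_pos {α : ℝ} (hα : -1 < α) (l : ℕ) : 0 < (l : ℝ) + 1 + α := by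
  have := l.cast_nonneg (α := ℝ); linarith

/-- The coefficientwise form of `zonal_add_two`. For `l ≥ 1` the hypothesis `-1 < α` keeps `l + α`
away from zero; for `l = 0` the quotient `2 α / (2 α)` is replaced by its value `1`, which covers `α
= 0`, that is `M = 2`. -/
lemma zonalCoeff_recurrence {α : ℝ} (hα : -1 < α) {j k l : ℕ} (h : j + 2 * k = l + 2) :
    (l + 2) * zonalCoeff α j k = (l + 2 + α) * (if j = 0 then 0 else zonalCoeff α (j - 1) k) -
      2 * (l + 2 + α) * lowerCoeff α l * (if k = 0 then 0 else zonalCoeff α j (k - 1)) := by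
  have hl : (l : ℝ) = j + 2 * k - 2 := by
    have : ((j + 2 * k : ℕ) : ℝ) = ((l + 2 : ℕ) : ℝ) := by rw [h]
    push_cast at this; linarith
  rcases j with _ | j <;> rcases k with _ | k
  · omega
  · rcases k with _ | k
    · obtain rfl : l = 0 := by omega
      simp [zonalCoeff, lowerCoeff, poch_zero]
      ring
    · have hl0 : l ≠ 0 := by omega
      have hpos := natCast_add_pos hα (2 * k + 1)
      have hlα : (l : ℝ) + α ≠ 0 := by
        rw [hl]; push_cast at *; linarith
      simp only [zonalCoeff, lowerCoeff, hl0]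
      simp only [zero_add, Nat.add_eq_zero_iff, one_ne_zero, and_false, if_false, if_true,
        Nat.add_sub_cancel, Nat.factorial_succ, poch_succ]
      rw [hl] at hlα ⊢
      push_cast at *
      field_simp
      ring
  · have hl0 : l + 1 = j := by omega
    obtain ⟨l, rfl⟩ : ∃ i, j = i + 1 := ⟨l, by omega⟩
    simp only [zonalCoeff]
    simp [Nat.factorial_succ, poch_succ]
    push_cast at hl
    rw [hl]
    field_simp
    ring
  · have hpos := natCast_add_pos hα (j + 2 * k)
    rcases Nat.eq_zero_or_pos (j + k) with h0 | h0
    · obtain ⟨rfl, rfl⟩ : j = 0 ∧ k = 0 := by omega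
      obtain rfl : l = 1 := by omega
      simp [zonalCoeff, lowerCoeff, poch_zero, poch_succ]
      norm_num at hpos
      field_simp
      ring
    · have hl0 : l ≠ 0 := by omega
      have hlα : (l : ℝ) + α ≠ 0 := by
        rw [hl]; push_cast at *; linarith
      obtain ⟨i, hi⟩ : ∃ i, j + k = i + 1 := ⟨j + k - 1, by omega⟩
      have e1 : j + 1 + (k + 1) - 1 = i + 2 := by omega
      have e2 : j + (k + 1) - 1 = i + 1 := by omega
      have e3 : j + 1 + k - 1 = i + 1 := by omega
      have hic : (i : ℝ) = j + k - 1 := by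
        have : ((j + k : ℕ) : ℝ) = ((i + 1 : ℕ) : ℝ) := by rw [hi]
        push_cast at this; linarith
      simp only [zonalCoeff, lowerCoeff, hl0, Nat.add_sub_cancel, e1, e2, e3]
      simp only [Nat.add_eq_zero_iff, one_ne_zero, and_false, false_and, if_false,
        Nat.factorial_succ, poch_succ]
      rw [hl] at hlα ⊢
      push_cast at *
      rw [hic]
      field_simp
      ring

lemma zonal_add_two {α : ℝ} (hα : -1 < α) (l : ℕ) (t : ℝ) :
    (l + 2) * zonal α (l + 2) t =
      2 * (l + 2 + α) * (t * zonal α (l + 1) t - lowerCoeff α l * zonal α l t) := by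
  have h1 : 2 * t * zonal α (l + 1) t = parSum (l + 2) fun j k =>
      (if j = 0 then 0 else zonalCoeff α (j - 1) k) * (2 * t) ^ j := by
    rw [parSum_shift_left (l + 1) (by simp), zonal, mul_parSum]
    refine parSum_congr fun j k _ => ?_
    simp only [Nat.add_eq_zero_iff, one_ne_zero, and_false, if_false, Nat.add_sub_cancel]
    ring
  have h2 : zonal α l t = parSum (l + 2) fun j k =>
      (if k = 0 then 0 else zonalCoeff α j (k - 1)) * (2 * t) ^ j := by
    rw [parSum_shift_right l (by simp), zonal]
    refine parSum_congr fun j k _ => ?_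
    simp
  have h3 : (l + 2) * zonal α (l + 2) t = (l + 2 + α) * (2 * t * zonal α (l + 1) t) +
      -(2 * (l + 2 + α) * lowerCoeff α l) * zonal α l t := by
    rw [h1, h2, zonal, mul_parSum, mul_parSum, mul_parSum, ← parSum_add]
    refine parSum_congr fun j k h => ?_
    rw [← mul_assoc, zonalCoeff_recurrence hα h]
    ring
  rw [h3]; ring

lemma mul_zonal_zero {α : ℝ} (hα : -1 < α) (t : ℝ) :
    t * zonal α 0 t = upperCoeff α 1 * zonal α 1 t := by
  have := natCast_add_pos hα 0
  norm_num at this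
  rw [zonal_zero, zonal_one, upperCoeff]
  push_cast
  field_simp

lemma mul_zonal_succ {α : ℝ} (hα : -1 < α) (l : ℕ) (t : ℝ) :
    t * zonal α (l + 1) t =
      upperCoeff α (l + 2) * zonal α (l + 2) t + lowerCoeff α l * zonal α l t := by
  have h := zonal_add_two hα l t
  have hp := natCast_add_pos hα (l + 1)
  rw [upperCoeff]
  push_cast at *
  have hp' : (l : ℝ) + 2 + α ≠ 0 := by linarith
  field_simp
  linear_combination -h

/-- Multiplication by `t` of an expansion in zonal polynomials. -/
lemma mul_parSum_zonal {α : ℝ} (hα : -1 < α) (q : ℕ → ℕ → ℝ) (m : ℕ) (t : ℝ) :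
    t * parSum m (fun l k => q l k * zonal α l t) = parSum (m + 1) fun l k =>
      (upperCoeff α l * (if l = 0 then 0 else q (l - 1) k) +
        lowerCoeff α l * (if k = 0 then 0 else q (l + 1) (k - 1))) * zonal α l t := by
  simp only [add_mul]
  rw [parSum_add, parSum_shift_left m (by simp)]
  rcases m with _ | m
  · rw [parSum_one, parSum_zero, parSum_zero]
    simp
    linear_combination q 0 0 * mul_zonal_zero hα t
  · rw [parSum_shift_right m (by simp)]
    have : parSum m (fun j k => lowerCoeff α j * (if k + 1 = 0 then 0 else q (j + 1) (k + 1 - 1)) *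
        zonal α j t) = parSum (m + 1) fun j k => q j k *
          (if j = 0 then 0 else lowerCoeff α (j - 1) * zonal α (j - 1) t) := by
      rw [parSum_shift_left m (by simp)]
      refine parSum_congr fun j k _ => ?_
      simp; ring
    rw [this, mul_parSum, ← parSum_add]
    refine parSum_congr fun j k _ => ?_
    rcases j with _ | j
    · simp
      linear_combination q 0 k * mul_zonal_zero hα t
    · simp
      have := mul_zonal_succ hα j t
      linear_combination q (j + 1) k * this

/-- The expansion of powers in zonal polynomials. -/
lemma pow_eq_parSum_zonal {α : ℝ} (hα : -1 < α) (m : ℕ) (t : ℝ) :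
    t ^ m = m.factorial / 2 ^ m *
      parSum m fun l k => (poch (α + 1) (l + k) * k.factorial)⁻¹ * zonal α l t := by
  induction m with
  | zero => simp [parSum_zero, poch_zero, zonal_zero]
  | succ m ih =>
    have key := mul_parSum_zonal hα (fun l k => (poch (α + 1) (l + k) * k.factorial)⁻¹) m t
    rw [pow_succ, ih, mul_assoc, mul_comm _ t, key, mul_parSum, mul_parSum]
    -- Both sides are now expansions in zonal polynomials, and only the coefficients are compared.
    -- The four cases below resolve the boundary conventions at `l = 0` and `k = 0`.
    refine parSum_congr fun l k h => ?_
    rw [← mul_assoc, ← mul_assoc]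
    congr 1
    have hm : (m : ℝ) = l + 2 * k - 1 := by
      have : ((l + 2 * k : ℕ) : ℝ) = ((m + 1 : ℕ) : ℝ) := by rw [h]
      push_cast at this; linarith
    have hp (n) : poch (α + 1) n ≠ 0 := (poch_pos (by linarith) n).ne'
    rw [Nat.factorial_succ, pow_succ]
    push_cast
    rw [hm]
    rcases l with _ | l <;> rcases k with _ | k
    · omega
    · have := hp k
      have := hp (k + 1)
      have h3 := natCast_add_pos hα k
      have h3' : α + 1 + k ≠ 0 := by linarith
      have h4 := Nat.factorial_ne_zero k
      simp only [lowerCoeff, upperCoeff, Nat.factorial_succ]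
      simp [Nat.add_comm 1 k, poch_succ]
      field_simp
    · have := hp l
      have := natCast_add_pos hα l
      have h3' : α + 1 + l ≠ 0 := by linarith
      simp only [lowerCoeff, upperCoeff, poch_succ]
      simp
      field_simp
      ring
    · have := hp (l + k)
      have := natCast_add_pos hα l
      have := natCast_add_pos hα (l + k)
      have := natCast_add_pos hα (l + k + 1)
      push_cast at *
      have h3' : α + 1 + ((l : ℝ) + k) ≠ 0 := by linarith
      have h4' : α + 1 + ((l : ℝ) + k + 1) ≠ 0 := by linarith
      have e1 : l + 1 + (k + 1) = l + k + 2 := by omega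
      have e2 : l + (k + 1) = l + k + 1 := by omega
      have e3 : l + 1 + 1 + k = l + k + 2 := by omega
      simp only [lowerCoeff, upperCoeff, Nat.factorial_succ]
      simp [e1, e2, e3, poch_succ]
      field_simp
      ring

/-- The coefficients connecting `C^λ` with the zonal polynomials of parameter `α`. -/
def connCoeff (α lam : ℝ) (l k : ℕ) : ℝ :=
  poch lam (l + k) * poch (lam - α) k / (poch (α + 1) (l + k) * k.factorial)

/-- The Gegenbauer polynomial `C_m^λ`, expanded in zonal polynomials of parameter `α`. -/
def gegenExp (α lam : ℝ) (m : ℕ) (t : ℝ) : ℝ :=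
  parSum m fun l k => connCoeff α lam l k * zonal α l t

lemma gegenExp_zero (α lam t : ℝ) : gegenExp α lam 0 t = 1 := by
  simp [gegenExp, parSum_zero, connCoeff, poch_zero, zonal_zero]

lemma gegenExp_one {α : ℝ} (hα : -1 < α) (lam t : ℝ) : gegenExp α lam 1 t = 2 * lam * t := by
  have : α + 1 ≠ 0 := by linarith
  simp [gegenExp, parSum_one, connCoeff, poch_zero, zonal_one, poch_succ]
  field_simp
  ring

/-- The classical three-term recurrence of `C_m^λ`, with multiplication by `t` carried out inside
the zonal expansion. Together with the values at `m = 0, 1` it is what produces the generating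
function. -/
lemma gegenExp_add_two {α : ℝ} (hα : -1 < α) (lam : ℝ) (m : ℕ) (t : ℝ) :
    (m + 2) * gegenExp α lam (m + 2) t =
      2 * (m + 1 + lam) * t * gegenExp α lam (m + 1) t - (m + 2 * lam) * gegenExp α lam m t := by
  have h2 : gegenExp α lam m t = parSum (m + 2) fun l k =>
      (if k = 0 then 0 else connCoeff α lam l (k - 1)) * zonal α l t := by
    rw [parSum_shift_right m (by simp), gegenExp]
    refine parSum_congr fun j k _ => ?_
    simp
  have h3 : (m + 2) * gegenExp α lam (m + 2) t =
      2 * (m + 1 + lam) * (t * gegenExp α lam (m + 1) t) +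
        -(m + 2 * lam) * gegenExp α lam m t := by
    rw [h2, gegenExp, gegenExp, mul_parSum_zonal hα, mul_parSum, mul_parSum, mul_parSum,
      ← parSum_add]
    refine parSum_congr fun l k h => ?_
    rw [← mul_assoc, ← mul_assoc, ← mul_assoc, ← add_mul]
    congr 1
    have hm : (m : ℝ) = l + 2 * k - 2 := by
      have : ((l + 2 * k : ℕ) : ℝ) = ((m + 2 : ℕ) : ℝ) := by rw [h]
      push_cast at this; linarith
    have hp (n) : poch (α + 1) n ≠ 0 := (poch_pos (by linarith) n).ne'
    rw [hm]
    rcases l with _ | l <;> rcases k with _ | k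
    · omega
    · have := hp k
      have h3 := natCast_add_pos hα k
      have h3' : α + 1 + k ≠ 0 := by linarith
      simp only [connCoeff, lowerCoeff, upperCoeff, Nat.factorial_succ, poch_succ]
      simp [Nat.add_comm 1 k, poch_succ]
      field_simp
      ring
    · have := hp l
      have := natCast_add_pos hα l
      have h3' : α + 1 + l ≠ 0 := by linarith
      simp only [connCoeff, lowerCoeff, upperCoeff, poch_succ]
      simp
      field_simp
      ring
    · have := hp (l + k)
      have := natCast_add_pos hα l
      have := natCast_add_pos hα (l + k)
      have := natCast_add_pos hα (l + k + 1)
      push_cast at *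
      have h3' : α + 1 + ((l : ℝ) + k) ≠ 0 := by linarith
      have h4' : α + 1 + ((l : ℝ) + k + 1) ≠ 0 := by linarith
      have e1 : l + 1 + (k + 1) = l + k + 2 := by omega
      have e2 : l + (k + 1) = l + k + 1 := by omega
      have e3 : l + 1 + 1 + k = l + k + 2 := by omega
      have e4 : l + 1 + k = l + k + 1 := by omega
      simp only [connCoeff, lowerCoeff, upperCoeff, Nat.factorial_succ]
      simp [e1, e2, e3, e4, poch_succ]
      field_simp
      ring
  rw [h3]; ring

/-- Needed for growth only: consecutive values have a rational ratio tending to `1`, so `zonal α l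
1` is subexponential in `l`. -/
lemma zonal_at_one {α : ℝ} (hα : -1 < α) (l : ℕ) :
    zonal α (l + 1) 1 = 2 * (l + 1 + α) * poch (2 * α + 1) l / (l + 1).factorial := by
  induction l using Nat.twoStepInduction with
  | zero => simp [zonal_one, poch_zero]
  | one =>
    have h := zonal_add_two hα 0 1
    simp [zonal_one, zonal_zero, lowerCoeff] at h
    simp [poch_succ, poch_zero]
    linarith
  | more l ih1 ih2 =>
    have h := zonal_add_two hα (l + 1) 1
    have h1 := natCast_add_pos hα l
    rw [ih1, ih2] at h
    push_cast at *
    have h3 : (l : ℝ) + 1 + 2 ≠ 0 := by positivity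
    apply mul_left_cancel₀ h3
    rw [show l + 2 + 1 = l + 1 + 2 by omega, h]
    simp only [lowerCoeff, Nat.factorial_succ, poch_succ]
    simp
    field_simp
    ring

/-- For `M = 2` the recurrence of the zonal polynomials at `α = 0` is the Chebyshev recurrence;
otherwise the factor `α` in `(α)_{j+k}` cancels. After this no dimension is special. -/
lemma normGegenbauer_eq_zonal {M : ℕ} (hM : 1 ≤ M) (l : ℕ) (t : ℝ) :
    normGegenbauer M l t = zonal ((M : ℝ) / 2 - 1) l t := by
  by_cases h2 : M = 2
  · subst h2
    have hα : (-1 : ℝ) < 0 := by norm_num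
    simp only [normGegenbauer, Nat.cast_ofNat, div_self (two_ne_zero' ℝ), sub_self, if_true]
    induction l using Nat.twoStepInduction with
    | zero => simp [zonal_zero]
    | one => simp [zonal_one]
    | more l ih1 ih2 =>
      have h := zonal_add_two hα l t
      rw [← ih1, ← ih2] at h
      have hT : (Polynomial.Chebyshev.T ℝ ((l + 2 : ℕ) : ℤ)).eval t =
          2 * t * (Polynomial.Chebyshev.T ℝ ((l + 1 : ℕ) : ℤ)).eval t -
            (Polynomial.Chebyshev.T ℝ (l : ℤ)).eval t := by
        push_cast
        rw [Polynomial.Chebyshev.T_add_two]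
        simp
      have hl : ((l : ℝ) + 2) ≠ 0 := by positivity
      apply mul_left_cancel₀ hl
      rw [h]
      rcases l with _ | l
      · rw [if_neg (by norm_num), hT]
        simp [lowerCoeff]
        ring
      · rw [if_neg (by omega), hT]
        simp [lowerCoeff]
        field_simp
  · have hα : (M : ℝ) / 2 - 1 ≠ 0 := by
      intro h
      apply h2
      have : (M : ℝ) = 2 := by linarith
      exact_mod_cast this
    rw [normGegenbauer, add_sub_assoc]
    generalize (M : ℝ) / 2 - 1 = α at hα ⊢
    rw [if_neg h2, zonal, parSum, gegenbauer, Finset.mul_sum]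
    refine Finset.sum_congr rfl fun k hk => ?_
    have hk' := Finset.mem_range.1 hk
    obtain ⟨j, hj⟩ : ∃ j, l = j + 2 * k := ⟨l - 2 * k, by omega⟩
    rw [show l - 2 * k = j by omega, show l - k = j + k by omega, zonalCoeff, ← mul_assoc]
    congr 1
    split_ifs with h0
    · obtain ⟨rfl, rfl⟩ : j = 0 ∧ k = 0 := by omega
      simp [hj, poch_zero, hα]
    · obtain ⟨i, hi⟩ : ∃ i, j + k = i + 1 := ⟨j + k - 1, by omega⟩
      rw [hi, poch_succ_left, Nat.add_sub_cancel, hj]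
      push_cast
      field_simp

/-! ### Harmonic polynomials: orthogonality and the Funk–Hecke type formula -/

/-- The linear form `x ↦ y · x`. -/
def linForm (y : Fin M → ℂ) : MvPolynomial (Fin M) ℂ := ∑ i, C (y i) * X i

/-- The polynomial `x · x`. -/
def sqForm (M : ℕ) : MvPolynomial (Fin M) ℂ := ∑ i, X i ^ 2

/-- The directional derivative along `y`. -/
def dirDeriv (y : Fin M → ℂ) (p : MvPolynomial (Fin M) ℂ) : MvPolynomial (Fin M) ℂ :=
  ∑ i, C (y i) * pderiv i p

lemma isHomogeneous_linForm (y : Fin M → ℂ) : (linForm y).IsHomogeneous 1 :=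
  IsHomogeneous.sum _ _ _ fun _ _ => isHomogeneous_C_mul_X _ _

lemma isHomogeneous_sqForm : (sqForm M).IsHomogeneous 2 :=
  IsHomogeneous.sum _ _ _ fun i _ => by simpa using (isHomogeneous_X ℂ i).pow 2

lemma isHomogeneous_linForm_pow (y : Fin M → ℂ) (m : ℕ) : (linForm y ^ m).IsHomogeneous m := by
  simpa using (isHomogeneous_linForm y).pow m

lemma pderiv_linForm (y : Fin M → ℂ) (i : Fin M) : pderiv i (linForm y) = C (y i) := by
  classical
  simp [linForm, pderiv_X, Pi.single_apply]

lemma pderiv_sqForm (i : Fin M) : pderiv i (sqForm M) = 2 * X i := by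
  classical
  simp [sqForm, pderiv_X, Pi.single_apply]

lemma lap_mul (f g : MvPolynomial (Fin M) ℂ) :
    lap (f * g) = lap f * g + 2 * ∑ i, pderiv i f * pderiv i g + f * lap g := by
  simp only [lap_apply, pderiv_mul, map_add, Finset.mul_sum, Finset.sum_mul]
  rw [← Finset.sum_add_distrib, ← Finset.sum_add_distrib]
  refine Finset.sum_congr rfl fun i _ => ?_
  ring

lemma lap_linForm_pow (y : Fin M → ℂ) (m : ℕ) :
    lap (linForm y ^ m) = C ((m : ℂ) * ((m - 1 : ℕ) : ℂ) * ∑ i, y i ^ 2) * linForm y ^ (m - 2) := by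
  simp only [lap_apply, pderiv_pow, pderiv_linForm, pderiv_mul, pderiv_C]
  simp only [Derivation.map_natCast, zero_mul, mul_zero, add_zero, zero_add, map_mul, map_sum,
    map_pow, map_natCast, Finset.mul_sum, Finset.sum_mul]
  refine Finset.sum_congr rfl fun i _ => ?_
  rw [show m - 1 - 1 = m - 2 by omega]
  ring

lemma lap_sqForm_pow (k : ℕ) :
    lap (sqForm M ^ (k + 1)) = C (2 * ((k : ℂ) + 1) * (2 * k + M)) * sqForm M ^ k := by
  simp only [lap_apply, pderiv_pow, pderiv_sqForm, pderiv_mul]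
  have h2 (i : Fin M) : pderiv i (2 : MvPolynomial (Fin M) ℂ) = 0 := by
    exact_mod_cast Derivation.map_natCast (pderiv i) 2
  have hn (i : Fin M) (n : ℕ) : pderiv i (n : MvPolynomial (Fin M) ℂ) = 0 :=
    Derivation.map_natCast (pderiv i) n
  rcases k with _ | k
  · simp [h2, mul_comm, map_ofNat C 2]
  · have (i : Fin M) : ((k + 1 + 1 : ℕ) : MvPolynomial (Fin M) ℂ) *
        (((k + 1 : ℕ) : MvPolynomial (Fin M) ℂ) * sqForm M ^ k * (2 * X i)) * (2 * X i) +
        ((k + 1 + 1 : ℕ) : MvPolynomial (Fin M) ℂ) * sqForm M ^ (k + 1) * 2 =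
        (4 * ((k : MvPolynomial (Fin M) ℂ) + 2) * ((k : MvPolynomial (Fin M) ℂ) + 1) * sqForm M ^ k) *
          X i ^ 2 + 2 * ((k : MvPolynomial (Fin M) ℂ) + 2) * sqForm M ^ (k + 1) := by
      push_cast; ring
    simp only [hn, h2, pderiv_X_self, Nat.add_sub_cancel, zero_mul, zero_add, mul_one, this]
    rw [Finset.sum_add_distrib, ← Finset.mul_sum, Finset.sum_const, Finset.card_univ,
      Fintype.card_fin, ← sqForm]
    simp only [map_mul, map_add, map_natCast, map_one, nsmul_eq_mul]
    rw [show C (2 : ℂ) = (2 : MvPolynomial (Fin M) ℂ) from map_ofNat C 2]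
    push_cast
    ring

/-- Homogeneous harmonic polynomials. -/
structure IsHarmonic (l : ℕ) (p : MvPolynomial (Fin M) ℂ) : Prop where
  hom : p.IsHomogeneous l
  lap_eq_zero : lap p = 0

lemma pderiv_pderiv_comm (i j : Fin M) (p : MvPolynomial (Fin M) ℂ) :
    pderiv i (pderiv j p) = pderiv j (pderiv i p) := by
  classical
  have : ⁅pderiv (R := ℂ) i, pderiv (R := ℂ) j⁆ = 0 := by
    refine derivation_ext fun k => ?_
    rw [Derivation.commutator_apply]
    simp only [pderiv_X, Pi.single_apply]
    split_ifs <;> simp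
  have h := congrArg (fun D => D p) this
  rw [Derivation.commutator_apply] at h
  exact sub_eq_zero.1 h

lemma lap_pderiv (i : Fin M) (p : MvPolynomial (Fin M) ℂ) :
    lap (pderiv i p) = pderiv i (lap p) := by
  simp only [lap_apply, map_sum]
  refine Finset.sum_congr rfl fun j _ => ?_
  rw [pderiv_pderiv_comm j i p, pderiv_pderiv_comm j i]

lemma IsHarmonic.pderiv {l : ℕ} {p : MvPolynomial (Fin M) ℂ} (hp : IsHarmonic l p) (i : Fin M) :
    IsHarmonic (l - 1) (pderiv i p) :=
  ⟨hp.hom.pderiv, by rw [lap_pderiv, hp.lap_eq_zero, map_zero]⟩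

lemma IsHarmonic.dirDeriv {l : ℕ} {p : MvPolynomial (Fin M) ℂ} (hp : IsHarmonic l p)
    (y : Fin M → ℂ) : IsHarmonic (l - 1) (dirDeriv y p) := by
  constructor
  · refine IsHomogeneous.sum _ _ _ fun i _ => ?_
    simpa using (isHomogeneous_C (Fin M) (y i)).mul (hp.pderiv i).hom
  · rw [Hyperspherical.dirDeriv, map_sum]
    refine Finset.sum_eq_zero fun i _ => ?_
    rw [← smul_eq_C_mul, map_smul, (hp.pderiv i).lap_eq_zero, smul_zero]

lemma isHomogeneous_zero_eq_C {p : MvPolynomial (Fin M) ℂ} (hp : p.IsHomogeneous 0) :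
    p = C (coeff 0 p) :=
  totalDegree_eq_zero_iff_eq_C.1 (Nat.le_zero.1 hp.totalDegree_le)

lemma IsHomogeneous.lap {l : ℕ} {p : MvPolynomial (Fin M) ℂ} (hp : p.IsHomogeneous l) :
    (lap p).IsHomogeneous (l - 2) := by
  rw [lap_apply]
  exact IsHomogeneous.sum _ _ _ fun i _ => hp.pderiv.pderiv

/-- A harmonic polynomial is orthogonal to the homogeneous polynomials of lower degree. -/
lemma sphInt_harmonic_mul_eq_zero (hM : 1 ≤ M) {l j : ℕ} {f h : MvPolynomial (Fin M) ℂ}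
    (hf : IsHarmonic l f) (hh : h.IsHomogeneous j) (hjl : j < l) : sphInt M (f * h) = 0 := by
  induction j using Nat.strong_induction_on generalizing l f h with
  | _ j ih =>
    have hfh : (f * h).IsHomogeneous (l + j) := hf.hom.mul hh
    have key := sphInt_lap hM hfh
    -- As `f` is harmonic, `Δ(f h) = 2 ∇f · ∇h + f Δh`. Each product pairs a harmonic polynomial
    -- with a factor of smaller degree than its own and than `j`, so the induction hypothesis
    -- applies.
    have hlap : sphInt M (lap (f * h)) = 0 := by
      rw [lap_mul, hf.lap_eq_zero, zero_mul, zero_add, map_add]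
      rcases Nat.eq_zero_or_pos j with rfl | hj
      · rw [isHomogeneous_zero_eq_C hh]
        simp [lap_apply]
      · have h1 : sphInt M (f * lap h) = 0 := by
          rcases Nat.lt_or_ge j 2 with h2 | h2
          · obtain rfl : j = 1 := by omega
            have : lap h = 0 := by
              rw [lap_apply]
              refine Finset.sum_eq_zero fun i _ => ?_
              rw [isHomogeneous_zero_eq_C (hh.pderiv (i := i)), pderiv_C]
            rw [this, mul_zero, map_zero]
          · exact ih (j - 2) (by omega) hf (IsHomogeneous.lap hh) (by omega)
        rw [h1, add_zero, two_mul, map_add, map_sum, Finset.sum_eq_zero, add_zero]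
        intro i _
        exact ih (j - 1) (by omega) (hf.pderiv i) hh.pderiv (by omega)
    rw [hlap] at key
    -- Since `l + j ≥ 1`, the factor `(l + j)(l + j + M - 2)` vanishes only for `l + j = M = 1`; in
    -- degree one the integral is zero by oddness.
    by_cases h1 : l + j = 1
    · exact sphInt_odd hM (by rw [h1]; exact odd_one) hfh
    · have e : ((l + j : ℕ) : ℂ) * (((l + j : ℕ) : ℂ) + M - 2) =
          ((l + j : ℕ) : ℂ) * ((l + j + M - 2 : ℕ) : ℂ) := by
        rw [Nat.cast_sub (by omega)]; push_cast; ring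
      rw [e] at key
      refine (mul_eq_zero.1 key.symm).resolve_left (mul_ne_zero ?_ ?_) <;>
        exact_mod_cast (by omega)

lemma eval_dirDeriv {l : ℕ} {p : MvPolynomial (Fin M) ℂ} (hp : p.IsHomogeneous l)
    (y : Fin M → ℂ) : eval y (dirDeriv y p) = l * eval y p := by
  have := congrArg (eval y) hp.sum_X_mul_pderiv
  simpa [dirDeriv] using this

/-- The sphere average of the product of a harmonic polynomial and a power of a linear form. -/
lemma sphInt_harmonic_mul_linForm_pow (hM : 1 ≤ M) {l : ℕ} (k : ℕ) {f : MvPolynomial (Fin M) ℂ}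
    (hf : IsHarmonic l f) (y : Fin M → ℂ) :
    sphInt M (f * linForm y ^ (l + 2 * k)) = sphereArea M *
      (((l + 2 * k).factorial / (2 ^ (l + 2 * k) * poch ((M : ℝ) / 2) (l + k) * k.factorial) : ℝ) *
        ((∑ i, y i ^ 2) ^ k * eval y f)) := by
  obtain ⟨m, hm⟩ : ∃ m, l + 2 * k = m := ⟨_, rfl⟩
  rw [hm]
  induction m using Nat.strong_induction_on generalizing l k f with
  | _ m ih =>
    have hM0 : (0 : ℝ) < M := by exact_mod_cast hM
    rcases Nat.eq_zero_or_pos m with rfl | hm0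
    · obtain ⟨rfl, rfl⟩ : l = 0 ∧ k = 0 := by omega
      rw [isHomogeneous_zero_eq_C hf.hom]
      simp [sphInt_C hM, poch_zero, mul_comm]
    -- The Laplacian of `f (y · x)^m` is `2 m (∂_y f)(y · x)^(m-1) + m (m-1) (y · y) f (y ·
    -- x)^(m-2)`. The first term has the pair `(l - 1, k)` and the second `(l, k - 1)`, so induction
    -- on `m = l + 2 k` closes; `∂_y f` takes the value `l f(y)` at `y` by Euler's identity.
    have key := sphInt_lap hM (hf.hom.mul (isHomogeneous_linForm_pow y m))
    have hgrad : ∑ i, pderiv i f * pderiv i (linForm y ^ m) =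
        (m : ℂ) • (dirDeriv y f * linForm y ^ (m - 1)) := by
      rw [dirDeriv, Finset.sum_mul, Finset.smul_sum]
      refine Finset.sum_congr rfl fun i _ => ?_
      rw [pderiv_pow, pderiv_linForm, smul_eq_C_mul, map_natCast]
      ring
    rw [lap_mul, hf.lap_eq_zero, zero_mul, zero_add, map_add, hgrad, lap_linForm_pow, two_mul,
      map_add, map_smul, mul_left_comm, ← smul_eq_C_mul, map_smul] at key
    simp only [smul_eq_mul] at key
    have hpc (n : ℕ) : (poch ((M : ℝ) / 2) n : ℂ) ≠ 0 := by
      exact_mod_cast (poch_pos (by positivity) n).ne'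
    obtain ⟨s, hs⟩ : ∃ s, l + k = s + 1 := ⟨l + k - 1, by omega⟩
    obtain ⟨m', rfl⟩ : ∃ m', m = m' + 1 := ⟨m - 1, by omega⟩
    have hA : sphInt M (dirDeriv y f * linForm y ^ m') = sphereArea M *
        ((m'.factorial / (2 ^ m' * poch ((M : ℝ) / 2) s * k.factorial) : ℝ) *
          ((∑ i, y i ^ 2) ^ k * (l * eval y f))) := by
      rcases Nat.eq_zero_or_pos l with rfl | hl
      · have : dirDeriv y f = 0 := by
          rw [isHomogeneous_zero_eq_C hf.hom]; simp [dirDeriv]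
        simp [this]
      · have := ih m' (by omega) k (hf.dirDeriv y) (by omega)
        rw [this, eval_dirDeriv hf.hom, show l - 1 + k = s by omega]
    have hB : ((m' : ℂ)) * (∑ i, y i ^ 2) * sphInt M (f * linForm y ^ (m' + 1 - 2)) = 
        sphereArea M * ((2 * k * (m'.factorial / (2 ^ m' * poch ((M : ℝ) / 2) s * k.factorial)) : ℝ) *
          ((∑ i, y i ^ 2) ^ k * eval y f)) := by
      -- For `k = 0` the power of the linear form has degree below `l`, so orthogonality removes
      -- this term, in accordance with the factor `2 k` on the right.
      rcases k with _ | k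
      · rcases m' with _ | m'
        · simp
        · rw [sphInt_harmonic_mul_eq_zero hM hf (isHomogeneous_linForm_pow y _) (by omega)]
          simp
      · obtain ⟨m'', rfl⟩ : ∃ m'', m' = m'' + 1 := ⟨m' - 1, by omega⟩
        rw [show m'' + 1 + 1 - 2 = m'' by omega, ih m'' (by omega) k hf (by omega),
          show l + k = s by omega]
        have := hpc s
        simp only [Nat.factorial_succ]
        push_cast
        field_simp
        ring
    have hfac : ((l + (m' + 1) : ℕ) : ℂ) * (((l + (m' + 1) : ℕ) : ℂ) + M - 2) =
        4 * (s + 1) * (s + M / 2) := by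
      have h1 : l + (m' + 1) = 2 * (s + 1) := by omega
      rw [h1]; push_cast; ring
    have hls : (l : ℂ) + k = s + 1 := by exact_mod_cast hs
    rw [hfac] at key
    simp only [Nat.add_sub_cancel] at key
    rw [hA, mul_assoc (((m' + 1 : ℕ) : ℂ)), mul_assoc (((m' + 1 : ℕ) : ℂ)), hB] at key
    have hne : (4 : ℂ) * (s + 1) * (s + M / 2) ≠ 0 := by
      have : ((4 * (s + 1) * (s + M / 2) : ℝ) : ℂ) ≠ 0 := by
        exact_mod_cast (by positivity)
      push_cast at this
      exact this
    apply mul_left_cancel₀ hne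
    rw [← key, hs, poch_succ, Nat.factorial_succ]
    have := hpc s
    have hsM : ((M : ℂ) + 2 * s) ≠ 0 := by
      have : ((M + 2 * s : ℝ) : ℂ) ≠ 0 := by exact_mod_cast (by positivity)
      push_cast at this
      exact this
    push_cast
    rw [show (M : ℂ) / 2 + s = (M + 2 * s) / 2 by ring]
    have hk : (k : ℂ) = s + 1 - l := by linear_combination hls
    field_simp
    rw [hk]
    ring

/-- The complexification of a vector. -/
def cvec (x : Euc M) : Fin M → ℂ := fun i => ((x i : ℝ) : ℂ)

lemma evalAt_eq (x : Euc M) (p : MvPolynomial (Fin M) ℂ) : evalAt x p = eval (cvec x) p := rfl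

lemma evalAt_mul (x : Euc M) (p q : MvPolynomial (Fin M) ℂ) :
    evalAt x (p * q) = evalAt x p * evalAt x q := by simp [evalAt]

lemma evalAt_pow (x : Euc M) (p : MvPolynomial (Fin M) ℂ) (n : ℕ) :
    evalAt x (p ^ n) = evalAt x p ^ n := by simp [evalAt]

lemma evalAt_prod {ι : Type*} (x : Euc M) (s : Finset ι) (p : ι → MvPolynomial (Fin M) ℂ) :
    evalAt x (∏ i ∈ s, p i) = ∏ i ∈ s, evalAt x (p i) := by simp [evalAt]

lemma evalAt_linForm (x y : Euc M) : evalAt x (linForm (cvec y)) = (inner ℝ y x : ℝ) := by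
  simp [evalAt, linForm, cvec, PiLp.inner_apply, mul_comm]

lemma sum_cvec_sq (x : Euc M) : ∑ i, cvec x i ^ 2 = ((‖x‖ ^ 2 : ℝ) : ℂ) := by
  simp [cvec, EuclideanSpace.real_norm_sq_eq]

lemma evalAt_sqForm (x : Euc M) : evalAt x (sqForm M) = ((‖x‖ ^ 2 : ℝ) : ℂ) := by
  rw [← sum_cvec_sq]
  simp [evalAt, sqForm, cvec]

lemma sum_cvec_sq_sphere (ω : USphere M) : ∑ i, cvec (ω : Euc M) i ^ 2 = 1 := by
  rw [sum_cvec_sq]; simp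

/-! ### Zonal harmonics and the angular function -/

/-- The Gegenbauer parameter attached to the dimension. -/
abbrev gegenParam (M : ℕ) : ℝ := (M : ℝ) / 2 - 1

lemma gegenParam_gt (hM : 1 ≤ M) : -1 < gegenParam M := by
  have : (1 : ℝ) ≤ M := by exact_mod_cast hM
  unfold gegenParam; linarith

/-- The solid zonal harmonic of degree `l` with axis `y`. -/
def solidZonal (y : Fin M → ℂ) (l : ℕ) : MvPolynomial (Fin M) ℂ :=
  parSum l fun j k =>
    ((zonalCoeff (gegenParam M) j k * 2 ^ j : ℝ) : ℂ) • (linForm y ^ j * sqForm M ^ k)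

lemma map_parSum {A B F : Type*} [AddCommMonoid A] [AddCommMonoid B] [FunLike F A B]
    [AddMonoidHomClass F A B] (g : F) (m : ℕ) (f : ℕ → ℕ → A) :
    g (parSum m f) = parSum m fun j k => g (f j k) := map_sum _ _ _

lemma isHomogeneous_linForm_pow_mul_sqForm_pow (y : Fin M → ℂ) (j k : ℕ) :
    (linForm y ^ j * sqForm M ^ k).IsHomogeneous (j + 2 * k) :=
  (isHomogeneous_linForm_pow y j).mul (isHomogeneous_sqForm.pow k)

lemma isHomogeneous_solidZonal (y : Fin M → ℂ) (l : ℕ) : (solidZonal y l).IsHomogeneous l := by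
  refine IsHomogeneous.sum _ _ _ fun k hk => ?_
  have hk' := Finset.mem_range.1 hk
  have := isHomogeneous_linForm_pow_mul_sqForm_pow y (l - 2 * k) k
  rw [show l - 2 * k + 2 * k = l by omega] at this
  exact (homogeneousSubmodule (Fin M) ℂ l).smul_mem _ this

lemma lap_linForm_pow_mul_sqForm_pow {y : Fin M → ℂ} (hy : ∑ i, y i ^ 2 = 1) (j k : ℕ) :
    lap (linForm y ^ j * sqForm M ^ k) =
      ((j : ℂ) * ((j - 1 : ℕ) : ℂ)) • (linForm y ^ (j - 2) * sqForm M ^ k) +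
      (2 * (k : ℂ) * (2 * j + 2 * k + M - 2)) • (linForm y ^ j * sqForm M ^ (k - 1)) := by
  have hgrad : ∑ i, pderiv i (linForm y ^ j) * pderiv i (sqForm M ^ k) =
      (2 * (j : ℂ) * k) • (linForm y ^ j * sqForm M ^ (k - 1)) := by
    rcases j with _ | j
    · simp
    have : ∀ i, pderiv i (linForm y ^ (j + 1)) * pderiv i (sqForm M ^ k) =
        (2 * ((j + 1 : ℕ) : MvPolynomial (Fin M) ℂ) * (k : MvPolynomial (Fin M) ℂ) * linForm y ^ j *
          sqForm M ^ (k - 1)) * (C (y i) * X i) := by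
      intro i
      rw [pderiv_pow, pderiv_pow, pderiv_linForm, pderiv_sqForm, Nat.add_sub_cancel]
      ring
    simp only [this]
    rw [← Finset.mul_sum, ← linForm, smul_eq_C_mul]
    simp only [map_mul, map_natCast, map_ofNat C 2]
    ring
  rw [lap_mul, hgrad, lap_linForm_pow, hy, mul_one]
  rcases k with _ | k
  · simp [smul_eq_C_mul, lap_apply]
  · rw [lap_sqForm_pow]
    simp only [smul_eq_C_mul, Nat.add_sub_cancel]
    push_cast
    simp only [map_mul, map_natCast, map_ofNat C 2, map_add, map_sub, map_one]
    ring

/-- The Laplacian sends the `(j, k)` term to multiples of the `(j - 2, k)` and `(j, k - 1)` terms.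
After shifting indices, both contributions to a given monomial in the two forms cancel by the choice
of `zonalCoeff`. -/
lemma isHarmonic_solidZonal (hM : 1 ≤ M) {y : Fin M → ℂ} (hy : ∑ i, y i ^ 2 = 1) (l : ℕ) :
    IsHarmonic l (solidZonal y l) := by
  refine ⟨isHomogeneous_solidZonal y l, ?_⟩
  simp only [solidZonal, map_parSum, map_smul, lap_linForm_pow_mul_sqForm_pow hy, smul_add,
    smul_smul]
  rw [parSum_add]
  rcases l with _ | _ | l
  · simp [parSum_zero]
  · simp [parSum_one]
  rw [parSum_shift_left (l + 1) (by simp), parSum_shift_left l (by simp),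
    parSum_shift_right l (by simp), ← parSum_add]
  refine Finset.sum_eq_zero fun k _ => ?_
  obtain ⟨j, hj⟩ : ∃ j, l - 2 * k = j := ⟨_, rfl⟩
  rw [hj]
  simp only [Nat.add_sub_cancel, show j + 1 + 1 - 2 = j by omega]
  rw [← add_smul]
  convert zero_smul ℂ _
  set α := gegenParam M with hα
  have hα1 := gegenParam_gt hM
  have hMα : (M : ℂ) = ((2 * α + 2 : ℝ) : ℂ) := by
    rw [hα]; push_cast; ring
  rw [hMα]
  simp only [zonalCoeff]
  rw [if_neg (by omega), if_neg (by omega), show j + 1 + 1 + k - 1 = j + k + 1 by omega,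
    show j + (k + 1) - 1 = j + k by omega, poch_succ]
  simp only [Nat.factorial_succ]
  have hj1 : (j : ℂ) + 1 + 1 ≠ 0 := by exact_mod_cast Nat.succ_ne_zero (j + 1)
  have hj2 : (j : ℂ) + 1 ≠ 0 := by exact_mod_cast Nat.succ_ne_zero j
  have hk1 : (k : ℂ) + 1 ≠ 0 := by exact_mod_cast Nat.succ_ne_zero k
  push_cast
  field_simp
  ring

lemma evalAt_solidZonal (ζ ω : USphere M) (l : ℕ) :
    evalAt (ω : Euc M) (solidZonal (cvec (ζ : Euc M)) l) =
      ((zonal (gegenParam M) l (inner ℝ (ζ : Euc M) (ω : Euc M)) : ℝ) : ℂ) := by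
  rw [evalAt, solidZonal, map_parSum, zonal, parSum, parSum, Complex.ofReal_sum]
  refine Finset.sum_congr rfl fun k _ => ?_
  have h1 := evalAt_linForm (ω : Euc M) (ζ : Euc M)
  have h2 := evalAt_sqForm (ω : Euc M)
  rw [evalAt] at h1 h2
  rw [smul_eval, map_mul, map_pow, map_pow, h1, h2]
  simp [mul_pow]
  ring

lemma angV_eq_sphInt (hM : 1 ≤ M) {N : ℕ} (l : Fin N → ℕ) (ζ : Fin N → USphere M) :
    ((angV l ζ : ℝ) : ℂ) =
      sphInt M (∏ i, solidZonal (cvec (ζ i : Euc M)) (l i)) / sphereArea M := by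
  rw [angV, Complex.ofReal_div, ← integral_complex_ofReal, sphInt_apply]
  congr 1
  refine integral_congr_ae (.of_forall fun ω => ?_)
  simp only [evalAt_prod, evalAt_solidZonal, normGegenbauer_eq_zonal hM, Complex.ofReal_prod]

/-- The reproducing property of zonal harmonics. -/
lemma sphInt_mul_solidZonal (hM : 1 ≤ M) {l : ℕ} {f : MvPolynomial (Fin M) ℂ}
    (hf : IsHarmonic l f) (ζ : USphere M) :
    sphInt M (f * solidZonal (cvec (ζ : Euc M)) l) = sphereArea M * evalAt (ζ : Euc M) f := by
  have hM0 : (0 : ℝ) < M := by exact_mod_cast hM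
  have hN : ∀ (p : MvPolynomial (Fin M) ℂ) (k : ℕ), sphInt M (p * sqForm M ^ k) = sphInt M p := by
    intro p k
    rw [sphInt_apply, sphInt_apply]
    refine integral_congr_ae (.of_forall fun ω => ?_)
    simp [evalAt_mul, evalAt_pow, evalAt_sqForm]
  -- On the sphere `sqForm` equals `1`, so a term with `k > 0` reduces to a power of the linear form
  -- of degree below `l`, orthogonal to `f`. Only the leading coefficient matters.
  have hterm : ∀ k ∈ Finset.range (l / 2 + 1), k ≠ 0 →
      sphInt M (f * ((zonalCoeff (gegenParam M) (l - 2 * k) k * 2 ^ (l - 2 * k) : ℝ) : ℂ) •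
        (linForm (cvec (ζ : Euc M)) ^ (l - 2 * k) * sqForm M ^ k)) = 0 := by
    intro k hk hk0
    have hk' := Finset.mem_range.1 hk
    rw [mul_smul_comm, map_smul, ← mul_assoc, hN,
      sphInt_harmonic_mul_eq_zero hM hf (isHomogeneous_linForm_pow _ _) (by omega), smul_zero]
  rw [solidZonal, parSum, Finset.mul_sum, map_sum,
    Finset.sum_eq_single_of_mem 0 (by simp) hterm]
  have h := sphInt_harmonic_mul_linForm_pow hM 0 hf (cvec (ζ : Euc M))
  simp only [mul_zero, add_zero, pow_zero, mul_one, one_mul, Nat.factorial_zero, Nat.cast_one]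
    at h
  simp only [mul_zero, Nat.sub_zero, pow_zero, mul_one]
  rw [mul_smul_comm, map_smul, h, smul_eq_mul, mul_left_comm,
    ← evalAt_eq, ← mul_assoc (_ : ℂ) (_ : ℂ) (evalAt _ _),
    ← Complex.ofReal_mul]
  have hp := poch_pos (a := (M : ℝ) / 2) (by positivity) l
  have : zonalCoeff (gegenParam M) l 0 * 2 ^ l *
      (l.factorial / (2 ^ l * poch ((M : ℝ) / 2) l)) = 1 := by
    have : zonalCoeff (gegenParam M) l 0 = poch ((M : ℝ) / 2) l / l.factorial := by
      rcases l with _ | l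
      · simp [zonalCoeff, poch_zero]
      · simp [zonalCoeff, poch_succ]
        ring
    rw [this]
    field_simp
  rw [this]; simp

lemma sphInt_zonal_mul_zonal (hM : 1 ≤ M) (l : ℕ) (ζ η : USphere M) :
    ∫ ω : USphere M, zonal (gegenParam M) l (inner ℝ (ζ : Euc M) (ω : Euc M)) *
      zonal (gegenParam M) l (inner ℝ (η : Euc M) (ω : Euc M)) ∂(surf M) =
      sphereArea M * zonal (gegenParam M) l (inner ℝ (ζ : Euc M) (η : Euc M)) := by
  have h := sphInt_mul_solidZonal hM (isHarmonic_solidZonal hM (sum_cvec_sq_sphere ζ) l) η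
  rw [evalAt_solidZonal, sphInt_apply] at h
  simp only [evalAt_mul, evalAt_solidZonal, ← Complex.ofReal_mul] at h
  rw [integral_complex_ofReal] at h
  exact_mod_cast h

lemma continuous_zonal (α : ℝ) (l : ℕ) : Continuous (zonal α l) := by
  unfold zonal parSum; fun_prop

lemma continuous_zonal_inner (l : ℕ) (ζ : USphere M) : Continuous fun ω : USphere M =>
    zonal (gegenParam M) l (inner ℝ (ζ : Euc M) (ω : Euc M)) :=
  (continuous_zonal _ _).comp (by fun_prop)

lemma inner_self_sphere (ζ : USphere M) : inner ℝ (ζ : Euc M) (ζ : Euc M) = (1 : ℝ) := by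
  rw [real_inner_self_eq_norm_sq]; simp

/-- The zonal polynomials attain their maximum at `1`. -/
lemma abs_zonal_inner_le (hM : 1 ≤ M) (l : ℕ) (ζ η : USphere M) :
    |zonal (gegenParam M) l (inner ℝ (ζ : Euc M) (η : Euc M))| ≤ zonal (gegenParam M) l 1 := by
  have hS := sphereArea_pos hM
  -- The value at `ζ · η` is an `L²` inner product of two functions whose squared norms both
  -- correspond to the value at `1`; the Cauchy–Schwarz bound follows from `2 |a b| ≤ a² + b²`.
  have h1 := sphInt_zonal_mul_zonal hM l ζ η
  have h2 := sphInt_zonal_mul_zonal hM l ζ ζ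
  have h3 := sphInt_zonal_mul_zonal hM l η η
  rw [inner_self_sphere] at h2 h3
  refine le_of_mul_le_mul_left ?_ hS
  rw [← abs_of_pos hS, ← abs_mul, abs_of_pos hS, ← h1]
  have hc := continuous_zonal_inner (M := M) l
  have hi (ζ : USphere M) : Integrable (fun ω : USphere M =>
      zonal (gegenParam M) l (inner ℝ (ζ : Euc M) (ω : Euc M)) *
        zonal (gegenParam M) l (inner ℝ (ζ : Euc M) (ω : Euc M))) (surf M) :=
    integrable_sphere ((hc ζ).mul (hc ζ))
  calc |∫ ω : USphere M, zonal (gegenParam M) l (inner ℝ (ζ : Euc M) (ω : Euc M)) *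
      zonal (gegenParam M) l (inner ℝ (η : Euc M) (ω : Euc M)) ∂(surf M)| 
      ≤ ∫ ω : USphere M, |zonal (gegenParam M) l (inner ℝ (ζ : Euc M) (ω : Euc M)) *
        zonal (gegenParam M) l (inner ℝ (η : Euc M) (ω : Euc M))| ∂(surf M) :=
        abs_integral_le_integral_abs
    _ ≤ ∫ ω : USphere M, (1 / 2 * (zonal (gegenParam M) l (inner ℝ (ζ : Euc M) (ω : Euc M)) *
          zonal (gegenParam M) l (inner ℝ (ζ : Euc M) (ω : Euc M))) +
        1 / 2 * (zonal (gegenParam M) l (inner ℝ (η : Euc M) (ω : Euc M)) *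
          zonal (gegenParam M) l (inner ℝ (η : Euc M) (ω : Euc M)))) ∂(surf M) := by
        refine integral_mono (integrable_sphere (((hc ζ).mul (hc η)).abs))
          (integrable_sphere ((((hc ζ).mul (hc ζ)).const_mul _).add
            (((hc η).mul (hc η)).const_mul _))) fun ω => ?_
        rw [abs_le]
        constructor <;> nlinarith [
          sq_nonneg (zonal (gegenParam M) l (inner ℝ (ζ : Euc M) (ω : Euc M)) +
            zonal (gegenParam M) l (inner ℝ (η : Euc M) (ω : Euc M))),
          sq_nonneg (zonal (gegenParam M) l (inner ℝ (ζ : Euc M) (ω : Euc M)) -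
            zonal (gegenParam M) l (inner ℝ (η : Euc M) (ω : Euc M)))]
    _ = sphereArea M * zonal (gegenParam M) l 1 := by
        rw [integral_add ((hi ζ).const_mul _) ((hi η).const_mul _), integral_const_mul,
          integral_const_mul, h2, h3]
        ring

lemma abs_angV_le (hM : 1 ≤ M) {N : ℕ} (l : Fin N → ℕ) (ζ : Fin N → USphere M) :
    |angV l ζ| ≤ ∏ i, zonal (gegenParam M) (l i) 1 := by
  have hS := sphereArea_pos hM
  rw [angV, abs_div, abs_of_pos hS, div_le_iff₀ hS, ← surf_real_univ hM]
  suffices hb : ∀ ω : USphere M, ‖∏ i, normGegenbauer M (l i) (inner ℝ (ζ i : Euc M) (ω : Euc M))‖ ≤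
      ∏ i, zonal (gegenParam M) (l i) 1 from
    norm_integral_le_of_norm_le_const (.of_forall hb)
  intro ω
  rw [Real.norm_eq_abs, Finset.abs_prod]
  refine Finset.prod_le_prod (fun _ _ => abs_nonneg _) fun i _ => ?_
  rw [normGegenbauer_eq_zonal hM]
  exact abs_zonal_inner_le hM _ _ _

lemma isHomogeneous_prod_solidZonal {ι : Type*} (s : Finset ι) (y : ι → Fin M → ℂ) (l : ι → ℕ) :
    (∏ i ∈ s, solidZonal (y i) (l i)).IsHomogeneous (∑ i ∈ s, l i) :=
  IsHomogeneous.prod _ _ _ fun _ _ => isHomogeneous_solidZonal _ _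

/-- The selection rule for the angular function. -/
lemma angV_selection (hM : 1 ≤ M) {n : ℕ} {l : Fin (n + 1) → ℕ} {ζ : Fin (n + 1) → USphere M}
    (h : angV l ζ ≠ 0) : Even (∑ p, l p) ∧ 2 * l (Fin.last n) ≤ ∑ p, l p := by
  have h0 : sphInt M (∏ i, solidZonal (cvec (ζ i : Euc M)) (l i)) ≠ 0 := by
    intro h0
    apply h
    have := angV_eq_sphInt hM l ζ
    rw [h0, zero_div] at this
    exact_mod_cast this
  -- Parity: a product of odd total degree integrates to zero. Triangle condition: if `l_N` exceeds
  -- the sum of the other indices, the last factor is a harmonic polynomial orthogonal to the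
  -- product of the others.
  constructor
  · by_contra hodd
    exact h0 (sphInt_odd hM (Nat.not_even_iff_odd.1 hodd) (isHomogeneous_prod_solidZonal _ _ _))
  · by_contra! hlt
    rw [Fin.sum_univ_castSucc] at hlt
    apply h0
    rw [Fin.prod_univ_castSucc, mul_comm]
    exact sphInt_harmonic_mul_eq_zero hM
      (isHarmonic_solidZonal hM (sum_cvec_sq_sphere _) _) (isHomogeneous_prod_solidZonal _ _ _)
      (by omega)

/-! ### Powers of a sum of vectors, expanded in zonal polynomials -/

/-- The total degree `∑ p, (l p + 2 μ p)` of a term of the multiple series. -/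
def termDegree {n : ℕ} (q : (Fin n → ℕ) × (Fin n → ℕ)) : ℕ := ∑ p, (q.1 p + 2 * q.2 p)

/-- The finite set of index pairs of total degree `m`. -/
def degreeSet (n m : ℕ) : Finset ((Fin n → ℕ) × (Fin n → ℕ)) :=
  (Fintype.piFinset (fun _ => Finset.range (m + 1)) ×ˢ
    Fintype.piFinset (fun _ => Finset.range (m + 1))).filter fun q => termDegree q = m

lemma mem_degreeSet {n m : ℕ} {q : (Fin n → ℕ) × (Fin n → ℕ)} :
    q ∈ degreeSet n m ↔ termDegree q = m := by
  simp only [degreeSet, Finset.mem_filter, Finset.mem_product, Fintype.mem_piFinset,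
    Finset.mem_range, and_iff_right_iff_imp]
  rintro rfl
  have h (p : Fin n) : q.1 p + 2 * q.2 p ≤ termDegree q :=
    Finset.single_le_sum (f := fun p => q.1 p + 2 * q.2 p) (fun _ _ => Nat.zero_le _)
      (Finset.mem_univ p)
  exact ⟨fun p => by have := h p; omega, fun p => by have := h p; omega⟩

lemma sum_sum_piAntidiag {A : Type*} [AddCommMonoid A] {n : ℕ} (m : ℕ)
    (F : (Fin n → ℕ) → (Fin n → ℕ) → A) :
    ∑ s ∈ Finset.univ.piAntidiag m, ∑ κ ∈ Fintype.piFinset fun p => Finset.range (s p / 2 + 1),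
      F (fun p => s p - 2 * κ p) κ = ∑ q ∈ degreeSet n m, F q.1 q.2 := by
  rw [Finset.sum_sigma']
  refine Finset.sum_nbij' (fun a => (fun p => a.1 p - 2 * a.2 p, a.2))
    (fun q => ⟨fun p => q.1 p + 2 * q.2 p, q.2⟩) ?_ ?_ ?_ ?_ ?_
  · rintro ⟨s, κ⟩ h
    simp only [Finset.mem_sigma, Finset.mem_piAntidiag, Fintype.mem_piFinset,
      Finset.mem_range] at h
    rw [mem_degreeSet, termDegree, ← h.1.1]
    refine Finset.sum_congr rfl fun p _ => ?_
    have := h.2 p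
    simp only
    omega
  · rintro q hq
    rw [mem_degreeSet, termDegree] at hq
    simp only [Finset.mem_sigma, Finset.mem_piAntidiag, Fintype.mem_piFinset, Finset.mem_range]
    exact ⟨⟨hq, by simp⟩, fun p => by omega⟩
  · rintro ⟨s, κ⟩ h
    simp only [Finset.mem_sigma, Fintype.mem_piFinset, Finset.mem_range] at h
    have : (fun p => s p - 2 * κ p + 2 * κ p) = s := by
      funext p
      have := h.2 p
      omega
    simp [this]
  · rintro q _
    simp
  · rintro _ _
    rfl

/-- The weight of a term in the expansion of a power of a sum in zonal polynomials. -/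
def termWeight {n : ℕ} (c : ℝ) (x : Fin n → ℝ) (q : (Fin n → ℕ) × (Fin n → ℕ)) : ℝ :=
  ∏ p, ((poch c (q.1 p + q.2 p) * (q.2 p).factorial)⁻¹ * x p ^ (q.1 p + 2 * q.2 p))

/-- The multinomial theorem followed by `pow_eq_parSum_zonal` in each factor: the factorials of the
exponents cancel the denominator of the multinomial coefficient, leaving `m! / 2^m` in front. -/
lemma sum_mul_pow_eq {α : ℝ} (hα : -1 < α) {n : ℕ} (m : ℕ) (x t : Fin n → ℝ) :
    (∑ p, x p * t p) ^ m = m.factorial / 2 ^ m *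
      ∑ q ∈ degreeSet n m, termWeight (α + 1) x q * ∏ p, zonal α (q.1 p) (t p) := by
  have h := sum_sum_piAntidiag (n := n) m fun l μ =>
    termWeight (α + 1) x (l, μ) * ∏ p, zonal α (l p) (t p)
  rw [← h, Finset.sum_pow_eq_sum_piAntidiag, Finset.mul_sum]
  refine Finset.sum_congr rfl fun s hs => ?_
  have hs' : ∑ p, s p = m := (Finset.mem_piAntidiag.1 hs).1
  have h1 : ∏ p, (x p * t p) ^ s p = (∏ p, ((s p).factorial : ℝ)) / 2 ^ m *
      ∏ p, ∑ k ∈ Finset.range (s p / 2 + 1),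
        (poch (α + 1) (s p - 2 * k + k) * k.factorial)⁻¹ * x p ^ (s p) *
          zonal α (s p - 2 * k) (t p) := by
    rw [← hs', ← Finset.prod_pow_eq_pow_sum, ← Finset.prod_div_distrib,
      ← Finset.prod_mul_distrib]
    refine Finset.prod_congr rfl fun p _ => ?_
    rw [mul_pow, pow_eq_parSum_zonal hα (s p) (t p), parSum, mul_left_comm, Finset.mul_sum]
    congr 1
    exact Finset.sum_congr rfl fun k _ => by ring
  have h2 : (Nat.multinomial Finset.univ s : ℝ) * ∏ p, ((s p).factorial : ℝ) = m.factorial := by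
    rw [mul_comm, ← hs']
    exact_mod_cast Nat.multinomial_spec Finset.univ s
  rw [h1, ← mul_assoc, mul_div_assoc', h2, Finset.prod_univ_sum]
  congr 1
  refine Finset.sum_congr rfl fun κ hκ => ?_
  rw [termWeight, ← Finset.prod_mul_distrib]
  refine Finset.prod_congr rfl fun p _ => ?_
  have := Finset.mem_range.1 (Fintype.mem_piFinset.1 hκ p)
  simp only
  rw [show s p - 2 * κ p + 2 * κ p = s p by omega]

lemma inner_sum_smul_sphere {n : ℕ} (x : Fin n → ℝ) (ζ : Fin n → USphere M) (ω : USphere M) :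
    inner ℝ (∑ p, x p • (ζ p : Euc M)) (ω : Euc M) =
      ∑ p, x p * inner ℝ (ζ p : Euc M) (ω : Euc M) := by
  rw [sum_inner]
  exact Finset.sum_congr rfl fun p _ => by rw [real_inner_smul_left]

/-- The addition of several vectors in the expansion in zonal harmonics. -/
lemma sum_termWeight_mul_angV (hM : 1 ≤ M) {n : ℕ} (x : Fin n → ℝ) (ζ : Fin (n + 1) → USphere M)
    (L k : ℕ) {ρ : ℝ} {η : USphere M} (hη : ∑ p, x p • (ζ p.castSucc : Euc M) = ρ • (η : Euc M)) :
    ∑ q ∈ degreeSet n (L + 2 * k), termWeight ((M : ℝ) / 2) x q *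
        angV (Fin.snoc q.1 L : Fin (n + 1) → ℕ) ζ =
      ρ ^ (L + 2 * k) * ((poch ((M : ℝ) / 2) (L + k) * k.factorial)⁻¹ *
        zonal (gegenParam M) L (inner ℝ (ζ (Fin.last n) : Euc M) (η : Euc M))) := by
  have hα := gegenParam_gt hM
  have hc : gegenParam M + 1 = (M : ℝ) / 2 := by unfold gegenParam; ring
  have hS := sphereArea_pos hM
  set m := L + 2 * k with hm
  set z := ζ (Fin.last n) with hz
  set y : Euc M := ∑ p, x p • (ζ p.castSucc : Euc M) with hy
  have hfac : ((m.factorial : ℝ) / 2 ^ m) ≠ 0 := by positivity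
  have hcz (l : ℕ) (w : USphere M) := continuous_zonal_inner l w
  -- The same integral is evaluated twice: here by expanding `y` in the `ζ p`, which produces the
  -- functions `angV`, and in `h2` by the Funk–Hecke type formula, which sees only `y = ρ η`.
  have h1 : ∫ ω : USphere M, inner ℝ y (ω : Euc M) ^ m *
      zonal (gegenParam M) L (inner ℝ (z : Euc M) (ω : Euc M)) ∂(surf M) =
      m.factorial / 2 ^ m * (sphereArea M * ∑ q ∈ degreeSet n m, termWeight ((M : ℝ) / 2) x q *
        angV (Fin.snoc q.1 L : Fin (n + 1) → ℕ) ζ) := by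
    have : ∀ ω : USphere M, inner ℝ y (ω : Euc M) ^ m *
        zonal (gegenParam M) L (inner ℝ (z : Euc M) (ω : Euc M)) =
        ∑ q ∈ degreeSet n m, m.factorial / 2 ^ m * termWeight ((M : ℝ) / 2) x q *
          ((∏ p, zonal (gegenParam M) (q.1 p) (inner ℝ (ζ p.castSucc : Euc M) (ω : Euc M))) *
            zonal (gegenParam M) L (inner ℝ (z : Euc M) (ω : Euc M))) := by
      intro ω
      rw [hy, inner_sum_smul_sphere x (fun p => ζ p.castSucc) ω, sum_mul_pow_eq hα, hc,
        Finset.mul_sum, Finset.sum_mul]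
      exact Finset.sum_congr rfl fun q _ => by ring
    simp only [this]
    rw [integral_finsetSum]
    · rw [Finset.mul_sum, Finset.mul_sum]
      refine Finset.sum_congr rfl fun q _ => ?_
      rw [integral_const_mul, angV, mul_assoc]
      congr 1
      rw [mul_left_comm, mul_div_cancel₀ _ hS.ne']
      congr 1
      refine integral_congr_ae (.of_forall fun ω => ?_)
      simp only [Fin.prod_univ_castSucc, Fin.snoc_castSucc, Fin.snoc_last,
        normGegenbauer_eq_zonal hM, hz]
    · intro q _
      refine (integrable_sphere ?_).const_mul _
      exact (continuous_finsetProd _ fun p _ => hcz _ _).mul (hcz _ _)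
  have h2 : ∫ ω : USphere M, inner ℝ y (ω : Euc M) ^ m *
      zonal (gegenParam M) L (inner ℝ (z : Euc M) (ω : Euc M)) ∂(surf M) =
      m.factorial / 2 ^ m * (sphereArea M * (ρ ^ m *
        ((poch ((M : ℝ) / 2) (L + k) * k.factorial)⁻¹ *
          zonal (gegenParam M) L (inner ℝ (z : Euc M) (η : Euc M))))) := by
    have h := sphInt_harmonic_mul_linForm_pow hM k
      (isHarmonic_solidZonal hM (sum_cvec_sq_sphere z) L) (cvec y)
    rw [sphInt_apply, ← hm, sum_cvec_sq, ← evalAt_eq, hη,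
      evalAt_smul (isHomogeneous_solidZonal _ _), evalAt_solidZonal, norm_smul] at h
    have hint : ∀ ω : USphere M, evalAt (ω : Euc M)
        (solidZonal (cvec (z : Euc M)) L * linForm (cvec (ρ • (η : Euc M))) ^ m) =
        ((inner ℝ y (ω : Euc M) ^ m *
          zonal (gegenParam M) L (inner ℝ (z : Euc M) (ω : Euc M)) : ℝ) : ℂ) := by
      intro ω
      rw [evalAt_mul, evalAt_pow, evalAt_solidZonal, evalAt_linForm, hη]
      push_cast; ring
    simp only [hint] at h
    rw [integral_complex_ofReal] at h
    have h' := congrArg Complex.re h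
    rw [Complex.ofReal_re] at h'
    rw [h', ← Complex.ofReal_re (m.factorial / 2 ^ m * _)]
    congr 1
    simp only [Real.norm_eq_abs, norm_eq_of_mem_sphere, mul_one, sq_abs]
    rw [hm]
    push_cast
    rw [show (ρ : ℂ) ^ (L + 2 * k) = ((ρ : ℂ) ^ 2) ^ k * (ρ : ℂ) ^ L by ring]
    field_simp
  rw [h1] at h2
  exact mul_left_cancel₀ hS.ne' (mul_left_cancel₀ hfac h2)

/-- The selection rule read off from the total degree: the terms `2 μ p` change neither the parity
nor the inequality, so a nonzero term has total degree `L + 2 k`. -/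
lemma angV_snoc_eq_zero (hM : 1 ≤ M) {n : ℕ} (ζ : Fin (n + 1) → USphere M) {L : ℕ}
    {q : (Fin n → ℕ) × (Fin n → ℕ)} (h : ∀ k, termDegree q ≠ L + 2 * k) :
    angV (Fin.snoc q.1 L : Fin (n + 1) → ℕ) ζ = 0 := by
  by_contra h0
  obtain ⟨⟨a, h1⟩, h2⟩ := angV_selection hM h0
  simp only [Fin.sum_univ_castSucc, Fin.snoc_castSucc, Fin.snoc_last] at h1 h2
  have : termDegree q = ∑ p, q.1 p + 2 * ∑ p, q.2 p := by
    rw [termDegree, Finset.sum_add_distrib, Finset.mul_sum]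
  exact h (a - L + ∑ p, q.2 p) (by omega)

/-! ### Subexponential growth and the generating function -/

/-- A sequence whose consecutive ratios tend to `1` grows subexponentially. -/
lemma exists_bound_of_ratio {u g : ℕ → ℝ} (hg : Tendsto g atTop (𝓝 1))
    (h : ∀ k, u (k + 1) = g k * u k) {θ : ℝ} (hθ : 1 < θ) :
    ∃ C, 0 < C ∧ ∀ k, |u k| ≤ C * θ ^ k := by
  obtain ⟨K, hK⟩ := eventually_atTop.1 ((hg.abs.eventually_lt_const (by simpa using hθ)))
  have h0 : 0 ≤ ∑ k ∈ Finset.range (K + 1), |u k| := Finset.sum_nonneg fun _ _ => abs_nonneg _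
  refine ⟨1 + ∑ k ∈ Finset.range (K + 1), |u k|, by linarith, fun k => ?_⟩
  rcases le_total k K with hk | hk
  · have h1 : |u k| ≤ ∑ k ∈ Finset.range (K + 1), |u k| :=
      Finset.single_le_sum (f := fun k => |u k|) (fun _ _ => abs_nonneg _)
        (Finset.mem_range.2 (by omega))
    have h2 : 1 ≤ θ ^ k := one_le_pow₀ hθ.le
    nlinarith
  · induction k, hk using Nat.le_induction with
    | base =>
      have h1 : |u K| ≤ ∑ k ∈ Finset.range (K + 1), |u k| :=
        Finset.single_le_sum (f := fun k => |u k|) (fun _ _ => abs_nonneg _)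
          (Finset.mem_range.2 (by omega))
      have h2 : 1 ≤ θ ^ K := one_le_pow₀ hθ.le
      nlinarith
    | succ k hk ih =>
      rw [h, abs_mul, pow_succ]
      have := (hK k hk).le
      calc |g k| * |u k| ≤ θ * ((1 + ∑ k ∈ Finset.range (K + 1), |u k|) * θ ^ k) := by
            gcongr
        _ = _ := by ring

lemma tendsto_add_div_add (a b : ℝ) :
    Tendsto (fun k : ℕ => (a + k) / (b + k)) atTop (𝓝 1) := by
  have h1 : Tendsto (fun k : ℕ => b + (k : ℝ)) atTop atTop :=
    tendsto_atTop_add_const_left _ _ tendsto_natCast_atTop_atTop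
  have h2 : Tendsto (fun k : ℕ => 1 + (a - b) / (b + k)) atTop (𝓝 (1 + 0)) :=
    tendsto_const_nhds.add (tendsto_const_nhds.div_atTop h1)
  rw [add_zero] at h2
  refine h2.congr' ?_
  filter_upwards [h1.eventually_gt_atTop 0] with k hk
  field_simp
  ring

lemma exists_abs_poch_le (a : ℝ) {θ : ℝ} (hθ : 1 < θ) :
    ∃ C, 0 < C ∧ ∀ k, |poch a k| ≤ C * θ ^ k * k.factorial := by
  obtain ⟨C, hC, h⟩ := exists_bound_of_ratio (u := fun k => poch a k / k.factorial)
    (tendsto_add_div_add a 1) (fun k => by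
      have : (1 : ℝ) + k ≠ 0 := by positivity
      rw [poch_succ, Nat.factorial_succ]; push_cast; field_simp; ring) hθ
  refine ⟨C, hC, fun k => ?_⟩
  have := h k
  have hk : (0 : ℝ) < k.factorial := by positivity
  rwa [abs_div, abs_of_pos hk, div_le_iff₀ hk] at this

lemma exists_poch_inv_le {c : ℝ} (hc : 0 < c) {θ : ℝ} (hθ : 1 < θ) :
    ∃ C, 0 < C ∧ ∀ k, (poch c k)⁻¹ ≤ C * θ ^ k / k.factorial := by
  obtain ⟨C, hC, h⟩ := exists_bound_of_ratio (u := fun k => k.factorial / poch c k)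
    (tendsto_add_div_add 1 c) (fun k => by
      have : c + k ≠ 0 := by positivity
      have := (poch_pos hc k).ne'
      rw [poch_succ, Nat.factorial_succ]; push_cast; field_simp; ring) hθ
  refine ⟨C, hC, fun k => ?_⟩
  have := h k
  have hk : (0 : ℝ) < k.factorial := by positivity
  have hp := poch_pos hc k
  rw [abs_of_pos (by positivity)] at this
  rw [le_div_iff₀ hk]
  refine le_trans (le_of_eq ?_) this
  rw [div_eq_mul_inv, mul_comm]

lemma exists_abs_zonal_one_le {α : ℝ} (hα : -1 < α) {θ : ℝ} (hθ : 1 < θ) :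
    ∃ C, 0 < C ∧ ∀ l, |zonal α l 1| ≤ C * θ ^ l := by
  obtain ⟨C, hC, h⟩ := exists_bound_of_ratio (u := fun l => zonal α (l + 1) 1)
    (g := fun l : ℕ => (2 * α + 1 + l) / (2 + l) * ((2 + α + l) / (1 + α + l)))
    (by simpa using (tendsto_add_div_add (2 * α + 1) 2).mul (tendsto_add_div_add (2 + α) (1 + α)))
    (fun l => by
      have h1 := natCast_add_pos hα l
      have h2 : 1 + α + (l : ℝ) ≠ 0 := by linarith
      have h3 : (2 : ℝ) + l ≠ 0 := by positivity
      have h4 : (l : ℝ) + 1 + 1 ≠ 0 := by positivity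
      rw [zonal_at_one hα, zonal_at_one hα, poch_succ, Nat.factorial_succ (l + 1)]
      push_cast
      field_simp
      ring) hθ
  refine ⟨C + 1, by linarith, fun l => ?_⟩
  rcases l with _ | l
  · simp [zonal_zero]; exact hC.le
  · refine (h l).trans ?_
    have : θ ^ l ≤ θ ^ (l + 1) := pow_le_pow_right₀ hθ.le (Nat.le_succ l)
    have : 0 < θ ^ l := by positivity
    nlinarith

lemma exists_natCast_add_one_le {θ : ℝ} (hθ : 1 < θ) :
    ∃ C, 0 < C ∧ ∀ k : ℕ, (k : ℝ) + 1 ≤ C * θ ^ k := by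
  obtain ⟨C, hC, h⟩ := exists_bound_of_ratio (u := fun k : ℕ => (k : ℝ) + 1)
    (tendsto_add_div_add 2 1) (fun k => by
      have : (1 : ℝ) + k ≠ 0 := by positivity
      push_cast; field_simp; ring) hθ
  exact ⟨C, hC, fun k => (le_abs_self _).trans (h k)⟩

lemma exists_one_lt_pow_eq {θ : ℝ} (hθ : 1 < θ) {n : ℕ} (hn : n ≠ 0) :
    ∃ s, 1 < s ∧ s ^ n = θ := by
  refine ⟨θ ^ (n : ℝ)⁻¹, Real.one_lt_rpow hθ (by positivity), ?_⟩
  exact Real.rpow_inv_natCast_pow (by linarith) hn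

/-- Subexponential growth of the Gegenbauer expansion. -/
lemma exists_abs_gegenExp_le {α : ℝ} (hα : -1 < α) (lam : ℝ) {t : ℝ}
    (ht : ∀ l, |zonal α l t| ≤ zonal α l 1) {θ : ℝ} (hθ : 1 < θ) :
    ∃ C, 0 < C ∧ ∀ m, |gegenExp α lam m t| ≤ C * θ ^ m := by
  -- The fifth root leaves room for the losses: each summand costs at most `s ^ (4 * m)`, and the
  -- number of summands at most a constant times `s ^ m`. The factorials cancel between the
  -- Pochhammer bounds.
  obtain ⟨s, hs, rfl⟩ := exists_one_lt_pow_eq hθ (n := 5) (by norm_num)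
  obtain ⟨C1, hC1, h1⟩ := exists_abs_poch_le lam hs
  obtain ⟨C2, hC2, h2⟩ := exists_abs_poch_le (lam - α) hs
  obtain ⟨C3, hC3, h3⟩ := exists_poch_inv_le (c := α + 1) (by linarith) hs
  obtain ⟨C4, hC4, h4⟩ := exists_abs_zonal_one_le hα hs
  obtain ⟨C5, hC5, h5⟩ := exists_natCast_add_one_le hs
  refine ⟨C1 * C2 * C3 * C4 * C5, by positivity, fun m => ?_⟩
  have hterm : ∀ k ∈ Finset.range (m / 2 + 1),
      |connCoeff α lam (m - 2 * k) k * zonal α (m - 2 * k) t| ≤ C1 * C2 * C3 * C4 * s ^ (4 * m) := by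
    intro k hk
    have hk' := Finset.mem_range.1 hk
    obtain ⟨l, hl⟩ : ∃ l, m = l + 2 * k := ⟨m - 2 * k, by omega⟩
    rw [show m - 2 * k = l by omega]
    have hp := poch_pos (a := α + 1) (by linarith) (l + k)
    have hf1 : (0 : ℝ) < (l + k).factorial := by positivity
    have hf2 : (0 : ℝ) < k.factorial := by positivity
    have hs0 : 0 < s := by linarith
    rw [connCoeff, abs_mul, abs_div, abs_mul, abs_of_pos (mul_pos hp hf2), div_eq_mul_inv,
      mul_inv]
    calc |poch lam (l + k)| * |poch (lam - α) k| * ((poch (α + 1) (l + k))⁻¹ *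
          (k.factorial : ℝ)⁻¹) * |zonal α l t|
        ≤ (C1 * s ^ (l + k) * (l + k).factorial) * (C2 * s ^ k * k.factorial) *
          ((C3 * s ^ (l + k) / (l + k).factorial) * (k.factorial : ℝ)⁻¹) * (C4 * s ^ l) := by
          gcongr
          · exact h1 _
          · exact h2 _
          · exact h3 _
          · exact (ht l).trans ((le_abs_self _).trans (h4 l))
      _ = C1 * C2 * C3 * C4 * s ^ (3 * l + 3 * k) := by
          rw [show 3 * l + 3 * k = (l + k) + k + (l + k) + l by ring]
          simp only [pow_add]
          field_simp
      _ ≤ C1 * C2 * C3 * C4 * s ^ (4 * m) := by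
          gcongr
          · exact hs.le
          · omega
  have hs0 : 0 < s := by linarith
  calc |gegenExp α lam m t| ≤ ∑ k ∈ Finset.range (m / 2 + 1),
        |connCoeff α lam (m - 2 * k) k * zonal α (m - 2 * k) t| := by
        rw [gegenExp, parSum]
        exact Finset.abs_sum_le_sum_abs _ _
    _ ≤ ((m / 2 + 1 : ℕ) : ℝ) * (C1 * C2 * C3 * C4 * s ^ (4 * m)) := by
        simpa using Finset.sum_le_card_nsmul _ _ _ hterm
    _ ≤ (C5 * s ^ m) * (C1 * C2 * C3 * C4 * s ^ (4 * m)) := by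
        gcongr
        refine le_trans ?_ (h5 m)
        exact_mod_cast (by omega)
    _ = C1 * C2 * C3 * C4 * C5 * (s ^ 5) ^ m := by
        rw [← pow_mul]; ring

/-- The generating function of the Gegenbauer polynomials `C_m^λ`. -/
lemma hasSum_gegenExp {α : ℝ} (hα : -1 < α) (lam : ℝ) {t : ℝ} (ht1 : |t| ≤ 1)
    (ht : ∀ l, |zonal α l t| ≤ zonal α l 1) {ρ : ℝ} (hρ0 : 0 ≤ ρ) (hρ : ρ < 1) :
    HasSum (fun m => gegenExp α lam m t * ρ ^ m) ((1 - 2 * t * ρ + ρ ^ 2) ^ (-lam)) := by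
  set c : ℕ → ℝ := fun m => gegenExp α lam m t with hc
  -- With `ρ < r < 1 < θ < 1 / r`, the coefficients are `O(θ ^ m)` and `θ * r < 1`, so the power
  -- series may be differentiated termwise for `|s| < r`.
  obtain ⟨r, hr1, hr2⟩ := exists_between hρ
  have hr0 : 0 < r := lt_of_le_of_lt hρ0 hr1
  obtain ⟨θ, hθ1, hθ2⟩ := exists_between (one_lt_one_div hr0 hr2)
  have hθr : θ * r < 1 := by rwa [lt_div_iff₀ hr0] at hθ2
  have hθ0 : 0 < θ := by linarith
  obtain ⟨C, hC, hb⟩ := exists_abs_gegenExp_le hα lam ht hθ1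
  have hgeo : Summable fun m : ℕ => ((m : ℝ) + 1) * (θ * r) ^ m := by
    have h1 := summable_pow_mul_geometric_of_norm_lt_one 1 (r := θ * r)
      (by rw [Real.norm_of_nonneg (by positivity)]; exact hθr)
    have h2 := summable_geometric_of_lt_one (r := θ * r) (by positivity) hθr
    simpa [add_mul] using h1.add h2
  have hB {s : ℝ} (hs : |s| < r) : Summable fun m => c m * s ^ m := by
    refine Summable.of_norm_bounded (hgeo.mul_left C) fun m => ?_
    rw [norm_mul, norm_pow, Real.norm_eq_abs, Real.norm_eq_abs]
    calc |c m| * |s| ^ m ≤ (C * θ ^ m) * r ^ m := by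
          gcongr
          exact hb m
      _ = C * (1 * (θ * r) ^ m) := by rw [mul_pow]; ring
      _ ≤ C * (((m : ℝ) + 1) * (θ * r) ^ m) := by
          gcongr
          have := m.cast_nonneg (α := ℝ); linarith
  have hA {s : ℝ} (hs : |s| < r) : Summable fun m : ℕ => ((m : ℝ) + 1) * c (m + 1) * s ^ m := by
    refine Summable.of_norm_bounded (hgeo.mul_left (C * θ)) fun m => ?_
    have hm : (0 : ℝ) ≤ (m : ℝ) + 1 := by positivity
    rw [norm_mul, norm_mul, norm_pow, Real.norm_eq_abs, Real.norm_eq_abs, Real.norm_eq_abs,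
      abs_of_nonneg hm]
    calc ((m : ℝ) + 1) * |c (m + 1)| * |s| ^ m ≤ ((m : ℝ) + 1) * (C * θ ^ (m + 1)) * r ^ m := by
          gcongr
          exact hb (m + 1)
      _ = C * θ * (((m : ℝ) + 1) * (θ * r) ^ m) := by rw [mul_pow]; ring
  set F : ℝ → ℝ := fun s => ∑' m, c m * s ^ m with hF
  set G : ℝ → ℝ := fun s => ∑' m : ℕ, ((m : ℝ) + 1) * c (m + 1) * s ^ m with hG
  have hderiv {s : ℝ} (hs : |s| < r) : HasDerivAt F (G s) s := by
    have hu : Summable fun m : ℕ => C * ((m : ℝ) * θ ^ m * r ^ (m - 1)) := by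
      refine Summable.mul_left C ?_
      rw [← summable_nat_add_iff 1]
      refine (hgeo.mul_left θ).congr fun m => ?_
      simp only [Nat.add_sub_cancel, mul_pow]
      push_cast
      ring
    have hd := hasDerivAt_tsum_of_isPreconnected (g := fun m s => c m * s ^ m)
      (g' := fun m s => c m * (m * s ^ (m - 1))) (t := Metric.ball (0 : ℝ) r) (y₀ := 0) (y := s) hu
      Metric.isOpen_ball (convex_ball _ _).isPreconnected
      (fun m s _ => (hasDerivAt_pow m s).const_mul (c m))
      (fun m s hs => by
        rw [mem_ball_zero_iff, Real.norm_eq_abs] at hs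
        rw [norm_mul, norm_mul, norm_pow, Real.norm_natCast, Real.norm_eq_abs, Real.norm_eq_abs]
        calc |c m| * ((m : ℝ) * |s| ^ (m - 1)) ≤ (C * θ ^ m) * ((m : ℝ) * r ^ (m - 1)) := by
              gcongr
              exact hb m
          _ = _ := by ring)
      (by simpa using hr0) (hB (by simpa using hr0)) (by simpa using hs)
    refine hd.congr_deriv ?_
    have hs' : Summable fun m : ℕ => c m * (m * s ^ (m - 1)) := by
      rw [← summable_nat_add_iff 1]
      refine (hA hs).congr fun m => ?_
      simp only [Nat.add_sub_cancel]; push_cast; ring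
    rw [hs'.tsum_eq_zero_add]
    simp only [hG, Nat.cast_zero, zero_mul, mul_zero, zero_add, Nat.add_sub_cancel]
    exact tsum_congr fun m => by push_cast; ring
  -- The three-term recurrence is this differential equation read coefficientwise; the constant
  -- terms are split off and matched with the values at `m = 0, 1`.
  have hode {s : ℝ} (hs : |s| < r) :
      (1 - 2 * t * s + s ^ 2) * G s = 2 * lam * (t - s) * F s := by
    have hA0 := (hA hs).hasSum
    have hB0 := (hB hs).hasSum
    have hA1 := (hasSum_nat_add_iff' 1).2 hA0
    have hB1 := (hasSum_nat_add_iff' 1).2 hB0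
    have hA2 : HasSum (fun m : ℕ => (m : ℝ) * c m * s ^ (m + 1)) (s ^ 2 * G s) := by
      rw [← hasSum_nat_add_iff' 1]
      simpa using (hA0.mul_left (s ^ 2)).congr_fun (g := fun m : ℕ => ((m + 1 : ℕ) : ℝ) *
        c (m + 1) * s ^ (m + 1 + 1)) fun m => by push_cast; ring
    have htot := (((hA1.add (hA0.mul_left (-2 * t * s))).add hA2).add
      (hB1.mul_left (-2 * lam * t))).add (hB0.mul_left (2 * lam * s))
    have hz : (fun m : ℕ => ((((m + 1 : ℕ) : ℝ) + 1) * c (m + 1 + 1) * s ^ (m + 1) +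
        -2 * t * s * (((m : ℝ) + 1) * c (m + 1) * s ^ m)) + (m : ℝ) * c m * s ^ (m + 1) +
        -2 * lam * t * (c (m + 1) * s ^ (m + 1)) + 2 * lam * s * (c m * s ^ m)) = fun _ => 0 := by
      funext m
      have := gegenExp_add_two hα lam m t
      push_cast
      rw [pow_succ]
      linear_combination s ^ m * s * this
    rw [hz] at htot
    have := htot.unique hasSum_zero
    simp only [Finset.sum_range_one, pow_zero, mul_one, Nat.cast_zero, zero_add, one_mul, hc,
      gegenExp_zero, gegenExp_one hα] at this
    simp only [hF, hG, hc]
    linear_combination this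
  -- The quadratic is at least `(1 - |s|)²`.
  have hpos {s : ℝ} (hs : |s| < r) : 0 < 1 - 2 * t * s + s ^ 2 := by
    have h1 : |s| < 1 := hs.trans hr2
    have h2 : |t * s| ≤ |s| := by
      rw [abs_mul]
      have := abs_nonneg s
      nlinarith
    have h3 := abs_le.1 h2
    have h4 : s ^ 2 = |s| ^ 2 := (sq_abs s).symm
    nlinarith
  have hconst := constant_of_has_deriv_right_zero (a := 0) (b := ρ)
    (f := fun s => F s * (1 - 2 * t * s + s ^ 2) ^ lam)
  -- By the differential equation `F` times the `lam`-th power of the quadratic has zero derivative;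
  -- hence it keeps the value `1` that it has at `0`.
  have hH {s : ℝ} (hs : |s| < r) :
      HasDerivAt (fun s => F s * (1 - 2 * t * s + s ^ 2) ^ lam) 0 s := by
    have hP : HasDerivAt (fun s : ℝ => 1 - 2 * t * s + s ^ 2) (-(2 * t) + 2 * s) s := by
      have h1 := (((hasDerivAt_id s).const_mul (2 * t)).const_sub 1).fun_add (hasDerivAt_pow 2 s)
      simpa using h1
    have h := (hderiv hs).fun_mul (hP.rpow_const (p := lam) (Or.inl (hpos hs).ne'))
    refine h.congr_deriv ?_
    have hp := hpos hs
    rw [Real.rpow_sub_one hp.ne']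
    have := hode hs
    field_simp
    linear_combination ((1 - 2 * t * s + s ^ 2) ^ lam) * this
  have habs {s : ℝ} (hs : s ∈ Set.Icc 0 ρ) : |s| < r := by
    rw [abs_of_nonneg hs.1]; exact hs.2.trans_lt hr1
  have hval := hconst (fun s hs => (hH (habs hs)).continuousAt.continuousWithinAt)
    (fun s hs => (hH (habs (Set.Ico_subset_Icc_self hs))).hasDerivWithinAt) ρ ⟨hρ0, le_rfl⟩
  have hρr := habs (s := ρ) ⟨hρ0, le_rfl⟩
  have hF0 : F 0 = 1 := by
    simp only [hF]
    rw [tsum_eq_single 0 (by intro m hm; simp [hm])]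
    simp [hc, gegenExp_zero]
  simp only [hF0] at hval
  have hFρ : F ρ = (1 - 2 * t * ρ + ρ ^ 2) ^ (-lam) := by
    rw [Real.rpow_neg (hpos hρr).le, eq_comm, inv_eq_iff_eq_inv, eq_comm, inv_eq_of_mul_eq_one_right]
    simpa using hval
  rw [← hFρ]
  exact (hB hρr).hasSum

lemma zonal_neg (α : ℝ) (l : ℕ) (t : ℝ) : zonal α l (-t) = (-1) ^ l * zonal α l t := by
  rw [zonal, zonal, mul_parSum]
  refine parSum_congr fun j k h => ?_
  rw [← h, pow_add, pow_mul]
  simp only [even_two, Even.neg_pow, one_pow, mul_one]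
  rw [show 2 * -t = -1 * (2 * t) by ring, mul_pow]
  ring

lemma pochReal_natCast (a : ℝ) (k : ℕ) : pochReal a k = poch a k := by
  simp [pochReal]

/-! ### Absolute convergence of the multiple series -/

/-- The general term of the expansion of a geometric series of a sum. -/
def multTerm {n : ℕ} (X : Fin n → ℝ) (a : Fin n → ℕ) : ℝ :=
  (∑ p, a p).factorial / (∏ p, ((a p).factorial : ℝ)) * ∏ p, X p ^ a p

lemma multTerm_nonneg {n : ℕ} {X : Fin n → ℝ} (hX : ∀ p, 0 ≤ X p) (a : Fin n → ℕ) :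
    0 ≤ multTerm X a :=
  mul_nonneg (by positivity) (Finset.prod_nonneg fun p _ => pow_nonneg (hX p) _)

lemma sum_multTerm {n : ℕ} (X : Fin n → ℝ) (m : ℕ) :
    ∑ a ∈ Finset.univ.piAntidiag m, multTerm X a = (∑ p, X p) ^ m := by
  rw [Finset.sum_pow_eq_sum_piAntidiag]
  refine Finset.sum_congr rfl fun a _ => ?_
  have h : (∏ p, ((a p).factorial : ℝ)) * Nat.multinomial Finset.univ a =
      (∑ p, a p).factorial := by
    exact_mod_cast Nat.multinomial_spec Finset.univ a
  have h0 : ∏ p, ((a p).factorial : ℝ) ≠ 0 := by positivity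
  rw [multTerm, ← h, mul_div_cancel_left₀ _ h0]

lemma multTerm_le {n : ℕ} {X : Fin n → ℝ} (hX : ∀ p, 0 ≤ X p) (a : Fin n → ℕ) :
    multTerm X a ≤ (∑ p, X p) ^ (∑ p, a p) := by
  rw [← sum_multTerm]
  exact Finset.single_le_sum (f := multTerm X) (fun a _ => multTerm_nonneg hX a) (by simp)

lemma summable_multTerm {n : ℕ} {X : Fin n → ℝ} (hX : ∀ p, 0 ≤ X p) (h1 : ∑ p, X p < 1) :
    Summable (multTerm X) := by
  have h0 : 0 ≤ ∑ p, X p := Finset.sum_nonneg fun p _ => hX p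
  refine summable_of_sum_le (c := (1 - ∑ p, X p)⁻¹) (multTerm_nonneg hX) fun u => ?_
  set N := u.sup (fun a => ∑ p, a p) + 1
  have hmaps : ∀ a ∈ u, ∑ p, a p ∈ Finset.range N := fun a ha =>
    Finset.mem_range.2 (Nat.lt_succ_of_le (Finset.le_sup (f := fun a => ∑ p, a p) ha))
  rw [← Finset.sum_fiberwise_of_maps_to hmaps]
  calc ∑ m ∈ Finset.range N, ∑ a ∈ u with ∑ p, a p = m, multTerm X a
      ≤ ∑ m ∈ Finset.range N, (∑ p, X p) ^ m := by
        refine Finset.sum_le_sum fun m _ => ?_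
        rw [← sum_multTerm]
        refine Finset.sum_le_sum_of_subset_of_nonneg (fun a ha => ?_)
          fun a _ _ => multTerm_nonneg hX a
        simp only [Finset.mem_filter] at ha
        simp [ha.2]
    _ ≤ ∑' m : ℕ, (∑ p, X p) ^ m :=
        (summable_geometric_of_lt_one h0 h1).sum_le_tsum _ fun m _ => pow_nonneg h0 m
    _ = _ := tsum_geometric_of_lt_one h0 h1

lemma exists_one_lt_mul_lt_one {σ : ℝ} (h0 : 0 ≤ σ) (h1 : σ < 1) : ∃ τ, 1 < τ ∧ τ * σ < 1 := by
  refine ⟨2 / (1 + σ), ?_, ?_⟩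
  · rw [lt_div_iff₀ (by linarith)]; linarith
  · rw [div_mul_eq_mul_div, div_lt_one (by linarith)]; linarith

/-- Log-convexity of the factorial: the pairs `(a, j + d)` and `(a + d, j)` have equal sums, and the
more spread one has the larger product. -/
lemma factorial_mul_factorial_le {a j : ℕ} (h : j ≤ a) (d : ℕ) :
    a.factorial * (j + d).factorial ≤ (a + d).factorial * j.factorial := by
  induction d with
  | zero => simp
  | succ d ih =>
    rw [← add_assoc, ← add_assoc, Nat.factorial_succ, Nat.factorial_succ]
    calc a.factorial * ((j + d + 1) * (j + d).factorial)
        = (j + d + 1) * (a.factorial * (j + d).factorial) := by ring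
      _ ≤ (a + d + 1) * ((a + d).factorial * j.factorial) := by gcongr
      _ = _ := by ring

/-- Up to subexponential factors the general term is the square of a multinomial term in the `x p`,
which is why the arguments are squares while the condition is `∑ x p < 1`. Multinomial terms are at
most `1`, so the square is dominated by the term itself. -/
lemma summable_lauricellaTerm {n : ℕ} (a b : ℝ) {c x : Fin n → ℝ} (hc : ∀ p, 0 < c p)
    (hx : ∀ p, 0 ≤ x p) (h1 : ∑ p, x p < 1) :
    Summable (lauricellaTerm a b c fun p => x p ^ 2) := by
  obtain ⟨τ, hτ1, hτ⟩ := exists_one_lt_mul_lt_one (Finset.sum_nonneg fun p _ => hx p) h1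
  -- The symbols with parameters `a`, `b` and `c` cost `s ^ j` each, together `τ ^ j`, and this is
  -- absorbed by replacing `x p` with `τ * x p`.
  obtain ⟨s, hs, hs3⟩ := exists_one_lt_pow_eq hτ1 (n := 3) (by norm_num)
  have hs0 : 0 < s := by linarith
  have hτ0 : 0 < τ := by linarith
  obtain ⟨C1, hC1, b1⟩ := exists_abs_poch_le a hs
  obtain ⟨C2, hC2, b2⟩ := exists_abs_poch_le b hs
  choose C3 hC3 b3 using fun p => exists_poch_inv_le (hc p) hs
  set X : Fin n → ℝ := fun p => τ * x p with hXdef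
  have hX : ∀ p, 0 ≤ X p := fun p => mul_nonneg hτ0.le (hx p)
  have hX1 : ∑ p, X p < 1 := by rwa [← Finset.mul_sum]
  refine Summable.of_norm_bounded ((summable_multTerm hX hX1).mul_left (C1 * C2 * ∏ p, C3 p))
    fun μ => ?_
  have hM1 : multTerm X μ ≤ 1 :=
    (multTerm_le hX μ).trans (pow_le_one₀ (Finset.sum_nonneg fun p _ => hX p) hX1.le)
  have hp (p) := poch_pos (hc p) (μ p)
  have hden : 0 < ∏ p, (poch (c p) (μ p) * ((μ p).factorial : ℝ)) :=
    Finset.prod_pos fun p _ => mul_pos (hp p) (by positivity)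
  have hxx : 0 ≤ ∏ p, (x p ^ 2) ^ μ p := Finset.prod_nonneg fun p _ => by positivity
  set j := ∑ p, μ p with hj
  have hnn (p : Fin n) : 0 ≤ (poch (c p) (μ p) * ((μ p).factorial : ℝ))⁻¹ * (x p ^ 2) ^ μ p :=
    mul_nonneg (inv_nonneg.2 (mul_nonneg (hp p).le (by positivity))) (by positivity)
  have hle (p : Fin n) : (poch (c p) (μ p) * ((μ p).factorial : ℝ))⁻¹ * (x p ^ 2) ^ μ p ≤
      C3 p * (s ^ μ p * ((((μ p).factorial : ℝ))⁻¹ * ((μ p).factorial : ℝ)⁻¹ *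
        (x p ^ μ p * x p ^ μ p))) := by
    rw [mul_inv, ← pow_mul, mul_comm 2, pow_mul, sq]
    have := b3 p (μ p)
    have hx0 : 0 ≤ x p ^ μ p * x p ^ μ p := mul_self_nonneg _
    calc _ ≤ (C3 p * s ^ μ p / (μ p).factorial) * ((μ p).factorial : ℝ)⁻¹ *
          (x p ^ μ p * x p ^ μ p) := by gcongr
      _ = _ := by ring
  rw [lauricellaTerm, Real.norm_eq_abs, abs_mul, abs_div, abs_mul, abs_of_pos hden,
    abs_of_nonneg hxx, div_eq_mul_inv, mul_assoc, ← Finset.prod_inv_distrib,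
    ← Finset.prod_mul_distrib]
  calc |poch a j| * |poch b j| * ∏ p, (poch (c p) (μ p) * ((μ p).factorial : ℝ))⁻¹ *
        (x p ^ 2) ^ μ p
      ≤ (C1 * s ^ j * j.factorial) * (C2 * s ^ j * j.factorial) *
        ∏ p, (C3 p * (s ^ μ p * ((((μ p).factorial : ℝ))⁻¹ * ((μ p).factorial : ℝ)⁻¹ *
          (x p ^ μ p * x p ^ μ p)))) := by
        have hprod := Finset.prod_le_prod (s := Finset.univ) (fun p _ => hnn p) fun p _ => hle p
        exact mul_le_mul (mul_le_mul (b1 j) (b2 j) (abs_nonneg _) (by positivity)) hprod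
          (Finset.prod_nonneg fun p _ => hnn p) (by positivity)
    _ = (C1 * C2 * ∏ p, C3 p) * (s ^ (3 * j) * (((j.factorial : ℝ) / ∏ p, ((μ p).factorial : ℝ)) *
          ∏ p, x p ^ μ p) ^ 2) := by
        simp only [Finset.prod_mul_distrib, Finset.prod_inv_distrib, Finset.prod_pow_eq_pow_sum,
          ← hj]
        ring
    _ ≤ (C1 * C2 * ∏ p, C3 p) * (τ ^ (2 * j) * (((j.factorial : ℝ) / ∏ p, ((μ p).factorial : ℝ)) *
          ∏ p, x p ^ μ p) ^ 2) := by
        have : 0 ≤ ∏ p, C3 p := Finset.prod_nonneg fun p _ => (hC3 p).le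
        gcongr
        rw [pow_mul, hs3]
        exact pow_le_pow_right₀ hτ1.le (by omega)
    _ = (C1 * C2 * ∏ p, C3 p) * multTerm X μ ^ 2 := by
        rw [multTerm]
        simp only [hXdef, mul_pow, Finset.prod_mul_distrib, Finset.prod_pow_eq_pow_sum, ← hj]
        ring
    _ ≤ (C1 * C2 * ∏ p, C3 p) * multTerm X μ := by
        have : 0 ≤ ∏ p, C3 p := Finset.prod_nonneg fun p _ => (hC3 p).le
        gcongr
        rw [sq]
        exact mul_le_of_le_one_left (multTerm_nonneg hX μ) hM1

/-- The ratios in which the multiple power series is expanded. -/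
def ratio {n : ℕ} (r : Fin (n + 1) → ℝ) (p : Fin n) : ℝ := r p.castSucc / r (Fin.last n)

/-- The two numerator Pochhammer symbols depend only on the last angular index and the total degree,
so they factor out when terms are grouped by these two numbers. -/
lemma seriesTerm_snoc {n : ℕ} (ν : ℝ) (r : Fin (n + 1) → ℝ) (ζ : Fin (n + 1) → USphere M)
    (L : ℕ) (q : (Fin n → ℕ) × (Fin n → ℕ)) :
    seriesTerm ν r ζ (Fin.snoc q.1 L : Fin (n + 1) → ℕ) q.2 =
      (-1) ^ L * (pochReal (ν / 2) (((termDegree q : ℝ) + L) / 2) *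
        pochReal (ν / 2 - gegenParam M) (((termDegree q : ℝ) - L) / 2)) *
        (termWeight ((M : ℝ) / 2) (ratio r) q *
          angV (Fin.snoc q.1 L : Fin (n + 1) → ℕ) ζ) := by
  have hh : halfSum (Fin.snoc q.1 L : Fin (n + 1) → ℕ) = ((∑ p, (q.1 p : ℝ)) + L) / 2 := by
    simp [halfSum, Fin.sum_univ_castSucc]
  have hd : (termDegree q : ℝ) = (∑ p, (q.1 p : ℝ)) + 2 * ∑ p, (q.2 p : ℝ) := by
    rw [termDegree, Nat.cast_sum, Finset.mul_sum, ← Finset.sum_add_distrib]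
    push_cast
    rfl
  have hw : termWeight ((M : ℝ) / 2) (ratio r) q =
      (∏ p, (poch ((M : ℝ) / 2) (q.1 p + q.2 p) * ((q.2 p).factorial : ℝ)))⁻¹ *
        ∏ p, (r p.castSucc / r (Fin.last n)) ^ (q.1 p + 2 * q.2 p) := by
    rw [termWeight, Finset.prod_mul_distrib, Finset.prod_inv_distrib]
    rfl
  simp only [seriesTerm, Fin.snoc_last, Fin.snoc_castSucc]
  rw [hh, hw, hd,
    show (∑ p, (q.2 p : ℝ)) + ((∑ p, (q.1 p : ℝ)) + L) / 2 =
      ((∑ p, (q.1 p : ℝ)) + 2 * ∑ p, (q.2 p : ℝ) + L) / 2 by ring,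
    show ((∑ p, (q.1 p : ℝ)) + 2 * ∑ p, (q.2 p : ℝ) + L) / 2 - L =
      ((∑ p, (q.1 p : ℝ)) + 2 * ∑ p, (q.2 p : ℝ) - L) / 2 by ring,
    show (ν - M + 2) / 2 = ν / 2 - gegenParam M by unfold gegenParam; ring]
  rw [div_eq_mul_inv]
  ring

lemma seriesTerm_snoc_of_eq {n : ℕ} (ν : ℝ) (r : Fin (n + 1) → ℝ) (ζ : Fin (n + 1) → USphere M)
    {L k : ℕ} {q : (Fin n → ℕ) × (Fin n → ℕ)} (h : termDegree q = L + 2 * k) :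
    seriesTerm ν r ζ (Fin.snoc q.1 L : Fin (n + 1) → ℕ) q.2 =
      (-1) ^ L * (poch (ν / 2) (L + k) * poch (ν / 2 - gegenParam M) k) *
        (termWeight ((M : ℝ) / 2) (ratio r) q *
          angV (Fin.snoc q.1 L : Fin (n + 1) → ℕ) ζ) := by
  rw [seriesTerm_snoc, h, ← pochReal_natCast, ← pochReal_natCast]
  congr 4 <;> push_cast <;> ring

lemma zonal_one_nonneg (hM : 1 ≤ M) (l : ℕ) : 0 ≤ zonal (gegenParam M) l 1 := by
  let ζ : USphere M := ⟨EuclideanSpace.single ⟨0, hM⟩ 1, by simp⟩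
  exact (abs_nonneg _).trans (abs_zonal_inner_le hM l ζ ζ)

lemma abs_angV_snoc_le (hM : 1 ≤ M) {n : ℕ} {C s : ℝ} (hC : 0 < C) (hs : 0 < s)
    (hb : ∀ l, |zonal (gegenParam M) l 1| ≤ C * s ^ l) (ζ : Fin (n + 1) → USphere M)
    (l : Fin n → ℕ) (L : ℕ) :
    |angV (Fin.snoc l L : Fin (n + 1) → ℕ) ζ| ≤ C ^ n * s ^ (∑ p, l p) * (C * s ^ L) := by
  refine (abs_angV_le hM _ ζ).trans ?_
  rw [Fin.prod_univ_castSucc]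
  simp only [Fin.snoc_castSucc, Fin.snoc_last]
  have hprod : ∏ p, zonal (gegenParam M) (l p) 1 ≤ ∏ p, C * s ^ l p :=
    Finset.prod_le_prod (fun p _ => zonal_one_nonneg hM _) fun p _ => (le_abs_self _).trans (hb _)
  rw [Finset.prod_mul_distrib, Finset.prod_const, Finset.card_univ, Fintype.card_fin,
    Finset.prod_pow_eq_pow_sum] at hprod
  exact mul_le_mul hprod ((le_abs_self _).trans (hb _)) (zonal_one_nonneg hM _) (by positivity)

lemma termWeight_nonneg {n : ℕ} {c : ℝ} (hc : 0 < c) {x : Fin n → ℝ} (hx : ∀ p, 0 ≤ x p)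
    (q : (Fin n → ℕ) × (Fin n → ℕ)) : 0 ≤ termWeight c x q :=
  Finset.prod_nonneg fun p _ => mul_nonneg
    (inv_nonneg.2 (mul_nonneg (poch_pos hc _).le (by positivity))) (pow_nonneg (hx p) _)

lemma termWeight_le {n : ℕ} {c C s : ℝ} (hc : 0 < c)
    (hb : ∀ k, (poch c k)⁻¹ ≤ C * s ^ k / k.factorial) {x : Fin n → ℝ} (hx : ∀ p, 0 ≤ x p)
    (l μ : Fin n → ℕ) :
    termWeight c x (l, μ) ≤ C ^ n * s ^ (∑ p, l p + ∑ p, μ p) *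
      ((∏ p, (((l + μ) p).factorial : ℝ))⁻¹ * (∏ p, ((μ p).factorial : ℝ))⁻¹ *
        ((∏ p, x p ^ (l + μ) p) * ∏ p, x p ^ μ p)) := by
  calc termWeight c x (l, μ)
      ≤ ∏ p, (C * (s ^ (l + μ) p * ((((l + μ) p).factorial : ℝ)⁻¹ * ((μ p).factorial : ℝ)⁻¹ *
        (x p ^ (l + μ) p * x p ^ μ p)))) := by
        refine Finset.prod_le_prod (fun p _ => mul_nonneg
          (inv_nonneg.2 (mul_nonneg (poch_pos hc _).le (by positivity))) (pow_nonneg (hx p) _))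
          fun p _ => ?_
        have h := hb (l p + μ p)
        have hxp : 0 ≤ x p ^ (l p + 2 * μ p) := pow_nonneg (hx p) _
        rw [mul_inv]
        calc _ ≤ (C * s ^ (l p + μ p) / (l p + μ p).factorial) * ((μ p).factorial : ℝ)⁻¹ *
              x p ^ (l p + 2 * μ p) := by gcongr
          _ = _ := by
              rw [show l p + 2 * μ p = (l p + μ p) + μ p by ring, pow_add (x p)]
              simp only [Pi.add_apply]
              ring
    _ = _ := by
        have hsum : ∑ p, (l + μ) p = ∑ p, l p + ∑ p, μ p := by simp [Finset.sum_add_distrib]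
        rw [Finset.prod_mul_distrib, Finset.prod_mul_distrib, Finset.prod_mul_distrib,
          Finset.prod_mul_distrib, Finset.prod_mul_distrib, Finset.prod_inv_distrib,
          Finset.prod_inv_distrib, Finset.prod_pow_eq_pow_sum, hsum, Finset.prod_const,
          Finset.card_univ, Fintype.card_fin]
        ring

lemma multTerm_const_mul {n : ℕ} (τ : ℝ) (x : Fin n → ℝ) (a : Fin n → ℕ) :
    multTerm (fun p => τ * x p) a = τ ^ (∑ p, a p) *
      ((∑ p, a p).factorial * ((∏ p, ((a p).factorial : ℝ))⁻¹ * ∏ p, x p ^ a p)) := by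
  rw [multTerm]
  simp only [mul_pow]
  rw [Finset.prod_mul_distrib, Finset.prod_pow_eq_pow_sum]
  ring

/-- The estimate of a term of the multiple power series, from the estimates of its factors. -/
lemma mul_le_of_factor_bounds {s C1 C2 C3 C4 p1 p2 w v B F1 F2 G1 G2 : ℝ} {n L k S T : ℕ}
    (hs : 1 < s) (hC1 : 0 < C1) (hC2 : 0 < C2) (hC3 : 0 < C3) (hC4 : 0 < C4)
    (hp2 : 0 ≤ p2) (hw : 0 ≤ w) (hv : 0 ≤ v) (hB : 0 ≤ B) (hF1 : 0 ≤ F1) (hF2 : 0 ≤ F2)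
    (h1 : p1 ≤ C1 * s ^ (L + k) * F1) (h2 : p2 ≤ C2 * s ^ k * F2)
    (h3 : w ≤ C3 ^ n * s ^ (S + T) * B) (h4 : v ≤ C4 ^ n * s ^ S * (C4 * s ^ L))
    (hdeg : S + 2 * T = L + 2 * k) (hfac : F1 * F2 ≤ G1 * G2) :
    p1 * p2 * (w * v) ≤ (C1 * C2 * C3 ^ n * C4 ^ n * C4) *
      ((s⁻¹ ^ L * s ^ (5 * (L + 2 * k))) * ((G1 * G2) * B)) := by
  have hs0 : 0 < s := by linarith
  -- With `D = L + 2 k = S + 2 T`, the exponent plus a spare `L` is `D + (2 S + T) + 2 L`, at most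
  -- `5 D`. The spare factor `s⁻¹ ^ L` makes the sum over `L` converge.
  have hexp : s ^ ((L + k) + k + (S + T) + S + L) ≤ s⁻¹ ^ L * s ^ (5 * (L + 2 * k)) := by
    rw [inv_pow, inv_mul_eq_div, le_div_iff₀ (by positivity), ← pow_add]
    exact pow_le_pow_right₀ hs.le (by omega)
  have hwv : w * v ≤ (C3 ^ n * s ^ (S + T) * B) * (C4 ^ n * s ^ S * (C4 * s ^ L)) :=
    (mul_le_mul_of_nonneg_left h4 hw).trans (mul_le_mul_of_nonneg_right h3 (by positivity))
  have hp : p1 * p2 ≤ (C1 * s ^ (L + k) * F1) * (C2 * s ^ k * F2) :=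
    mul_le_mul h1 h2 hp2 (by positivity)
  calc p1 * p2 * (w * v)
      ≤ (C1 * s ^ (L + k) * F1) * (C2 * s ^ k * F2) *
        ((C3 ^ n * s ^ (S + T) * B) * (C4 ^ n * s ^ S * (C4 * s ^ L))) :=
        mul_le_mul hp hwv (mul_nonneg hw hv) (by positivity)
    _ = (C1 * C2 * C3 ^ n * C4 ^ n * C4) *
          (s ^ ((L + k) + k + (S + T) + S + L) * ((F1 * F2) * B)) := by
        simp only [pow_add]; ring
    _ ≤ _ := mul_le_mul_of_nonneg_left (mul_le_mul hexp
        (mul_le_mul_of_nonneg_right hfac hB) (by positivity) (by positivity)) (by positivity)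

/-- Writing `l + 2 μ = (l + μ) + μ` splits the powers and the denominators into two multinomial
patterns, at `l + μ` and at `μ`; `factorial_mul_factorial_le` turns the numerator factorials into
those these patterns require. -/
lemma abs_seriesTerm_snoc_le (hM : 1 ≤ M) {n : ℕ} {ν : ℝ} {r : Fin (n + 1) → ℝ}
    (ζ : Fin (n + 1) → USphere M) (hx : ∀ p, 0 ≤ ratio r p) {s C1 C2 C3 C4 : ℝ} (hs : 1 < s)
    (hC1 : 0 < C1) (hC2 : 0 < C2) (hC3 : 0 < C3) (hC4 : 0 < C4)
    (b1 : ∀ k, |poch (ν / 2) k| ≤ C1 * s ^ k * k.factorial)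
    (b2 : ∀ k, |poch (ν / 2 - gegenParam M) k| ≤ C2 * s ^ k * k.factorial)
    (b3 : ∀ k, (poch ((M : ℝ) / 2) k)⁻¹ ≤ C3 * s ^ k / k.factorial)
    (b4 : ∀ l, |zonal (gegenParam M) l 1| ≤ C4 * s ^ l) (L : ℕ) (l μ : Fin n → ℕ) :
    |seriesTerm ν r ζ (Fin.snoc l L : Fin (n + 1) → ℕ) μ| ≤ (C1 * C2 * C3 ^ n * C4 ^ n * C4) *
      ((s⁻¹) ^ L * (multTerm (fun p => s ^ 5 * ratio r p) (l + μ) *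
        multTerm (fun p => s ^ 5 * ratio r p) μ)) := by
  have hs0 : 0 < s := by linarith
  have hc : (0 : ℝ) < (M : ℝ) / 2 := by
    have : (1 : ℝ) ≤ M := by exact_mod_cast hM
    linarith
  by_cases hV : angV (Fin.snoc l L : Fin (n + 1) → ℕ) ζ = 0
  · have hX : ∀ p, 0 ≤ s ^ 5 * ratio r p := fun p => mul_nonneg (by positivity) (hx p)
    have h1 := multTerm_nonneg hX (l + μ)
    have h2 := multTerm_nonneg hX μ
    have hC : 0 ≤ C1 * C2 * C3 ^ n * C4 ^ n * C4 := by positivity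
    rw [seriesTerm, hV, mul_zero, zero_mul, zero_mul, abs_zero]
    exact mul_nonneg hC (mul_nonneg (by positivity) (mul_nonneg h1 h2))
  obtain ⟨k, hk⟩ : ∃ k, termDegree (l, μ) = L + 2 * k := by
    by_contra! h
    exact hV (angV_snoc_eq_zero (q := (l, μ)) hM ζ h)
  have hsel := (angV_selection hM hV).2
  simp only [Fin.sum_univ_castSucc, Fin.snoc_castSucc, Fin.snoc_last] at hsel
  have hdeg : ∑ p, l p + 2 * ∑ p, μ p = L + 2 * k := by
    rw [← hk, termDegree, Finset.sum_add_distrib, Finset.mul_sum]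
  have hsumadd : ∑ p, (l + μ) p = ∑ p, l p + ∑ p, μ p := by
    simp [Finset.sum_add_distrib]
  -- The selection rule gives `L ≤ ∑ l p`, and comparison with the total degree then gives `∑ μ p ≤
  -- k`.
  obtain ⟨d, hd⟩ : ∃ d, k = ∑ p, μ p + d := ⟨k - ∑ p, μ p, by omega⟩
  have hfac : ((L + k).factorial : ℝ) * k.factorial ≤
      (∑ p, (l + μ) p).factorial * (∑ p, μ p).factorial := by
    have := factorial_mul_factorial_le (a := L + k) (j := ∑ p, μ p) (by omega) d
    rw [← hd, show L + k + d = ∑ p, (l + μ) p by rw [hsumadd]; omega] at this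
    exact_mod_cast this
  have hVb := abs_angV_snoc_le hM hC4 hs0 b4 ζ l L
  have hw0 := termWeight_nonneg hc hx (l, μ)
  have hwb := termWeight_le hc b3 hx l μ
  have hB0 : 0 ≤ (∏ p, (((l + μ) p).factorial : ℝ))⁻¹ * (∏ p, ((μ p).factorial : ℝ))⁻¹ *
        ((∏ p, ratio r p ^ (l + μ) p) * ∏ p, ratio r p ^ μ p) := by
    have h1 : 0 ≤ ∏ p, ratio r p ^ (l + μ) p :=
      Finset.prod_nonneg fun p _ => pow_nonneg (hx p) _
    have h2 : 0 ≤ ∏ p, ratio r p ^ μ p := Finset.prod_nonneg fun p _ => pow_nonneg (hx p) _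
    positivity
  have heq := seriesTerm_snoc_of_eq ν r ζ hk
  simp only at heq
  rw [heq, abs_mul, abs_mul, abs_mul, abs_mul, abs_pow, abs_neg, abs_one,
    one_pow, one_mul, abs_of_nonneg hw0, multTerm_const_mul, multTerm_const_mul]
  have hrhs (A B P1 P2 Q1 Q2 : ℝ) (i j : ℕ) (hij : i + j = L + 2 * k) :
      s⁻¹ ^ L * ((s ^ 5) ^ i * (A * (P1 * Q1)) * ((s ^ 5) ^ j * (B * (P2 * Q2)))) =
      (s⁻¹ ^ L * s ^ (5 * (L + 2 * k))) * ((A * B) * (P1 * P2 * (Q1 * Q2))) := by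
    rw [← hij, mul_add, pow_add s, pow_mul, pow_mul]
    ring
  rw [hrhs _ _ _ _ _ _ _ _ (by rw [hsumadd, ← hdeg]; ring)]
  exact mul_le_of_factor_bounds hs hC1 hC2 hC3 hC4 (abs_nonneg _) hw0 (abs_nonneg _) hB0
    (Nat.cast_nonneg _) (Nat.cast_nonneg _) (b1 _) (b2 _) hwb hVb hdeg hfac

/-- The absolute convergence of the multiple power series. -/
lemma summable_seriesTerm_snoc (hM : 1 ≤ M) {n : ℕ} (ν : ℝ) (r : Fin (n + 1) → ℝ)
    (ζ : Fin (n + 1) → USphere M) (hx : ∀ p, 0 ≤ ratio r p) (h1 : ∑ p, ratio r p < 1) :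
    Summable fun a : ℕ × ((Fin n → ℕ) × (Fin n → ℕ)) =>
      seriesTerm ν r ζ (Fin.snoc a.2.1 a.1 : Fin (n + 1) → ℕ) a.2.2 := by
  obtain ⟨τ, hτ1, hτ⟩ := exists_one_lt_mul_lt_one (Finset.sum_nonneg fun p _ => hx p) h1
  obtain ⟨s, hs, rfl⟩ := exists_one_lt_pow_eq hτ1 (n := 5) (by norm_num)
  have hs0 : 0 < s := by linarith
  have hc : (0 : ℝ) < (M : ℝ) / 2 := by
    have : (1 : ℝ) ≤ M := by exact_mod_cast hM
    linarith
  obtain ⟨C1, hC1, b1⟩ := exists_abs_poch_le (ν / 2) hs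
  obtain ⟨C2, hC2, b2⟩ := exists_abs_poch_le (ν / 2 - gegenParam M) hs
  obtain ⟨C3, hC3, b3⟩ := exists_poch_inv_le hc hs
  obtain ⟨C4, hC4, b4⟩ := exists_abs_zonal_one_le (gegenParam_gt hM) hs
  have hX : ∀ p, 0 ≤ s ^ 5 * ratio r p := fun p => mul_nonneg (by positivity) (hx p)
  have hm := summable_multTerm hX (by rwa [← Finset.mul_sum])
  have h2 := hm.mul_of_nonneg hm (multTerm_nonneg hX) (multTerm_nonneg hX)
  have h3 : Summable fun q : (Fin n → ℕ) × (Fin n → ℕ) =>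
      multTerm (fun p => s ^ 5 * ratio r p) (q.1 + q.2) *
        multTerm (fun p => s ^ 5 * ratio r p) q.2 := by
    -- The map `(l, μ) ↦ (l + μ, μ)` is injective, so the double sum is a subsum of a product of two
    -- convergent series.
    refine h2.comp_injective (i := fun q : (Fin n → ℕ) × (Fin n → ℕ) => (q.1 + q.2, q.2)) ?_
    rintro ⟨a, b⟩ ⟨a', b'⟩ h
    simp only [Prod.mk.injEq] at h
    obtain ⟨h, rfl⟩ := h
    simpa using h
  have hsum := (summable_geometric_of_lt_one (inv_nonneg.2 hs0.le)
    (inv_lt_one_of_one_lt₀ hs)).mul_of_nonneg h3 (fun L => by positivity)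
    (fun q => mul_nonneg (multTerm_nonneg hX _) (multTerm_nonneg hX _))
  exact Summable.of_norm_bounded (hsum.mul_left (C1 * C2 * C3 ^ n * C4 ^ n * C4)) fun a =>
    abs_seriesTerm_snoc_le hM ζ hx hs hC1 hC2 hC3 hC4 b1 b2 b3 b4 a.1 a.2.1 a.2.2

/-! ### Summation by total degree -/

/-- This recovers one term of the connection formula: `k` is half the excess of the total degree
over `L`, and `(-1) ^ L` is absorbed as a sign of the argument by the parity of the zonal
polynomial. -/
lemma sum_degreeSet_seriesTerm (hM : 1 ≤ M) {n : ℕ} (ν : ℝ) (r : Fin (n + 1) → ℝ)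
    (ζ : Fin (n + 1) → USphere M) (L k : ℕ) {ρ : ℝ} {η : USphere M}
    (hη : ∑ p, ratio r p • (ζ p.castSucc : Euc M) = ρ • (η : Euc M)) :
    ∑ q ∈ degreeSet n (L + 2 * k), seriesTerm ν r ζ (Fin.snoc q.1 L : Fin (n + 1) → ℕ) q.2 =
      connCoeff (gegenParam M) (ν / 2) L k *
        zonal (gegenParam M) L (-inner ℝ (ζ (Fin.last n) : Euc M) (η : Euc M)) *
          ρ ^ (L + 2 * k) := by
  rw [Finset.sum_congr rfl fun q hq => seriesTerm_snoc_of_eq ν r ζ (mem_degreeSet.1 hq),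
    ← Finset.mul_sum, sum_termWeight_mul_angV hM _ ζ L k hη, zonal_neg, connCoeff,
    show gegenParam M + 1 = (M : ℝ) / 2 by unfold gegenParam; ring, div_eq_mul_inv]
  ring

lemma sum_degreeSet_seriesTerm_eq_zero (hM : 1 ≤ M) {n : ℕ} (ν : ℝ) (r : Fin (n + 1) → ℝ)
    (ζ : Fin (n + 1) → USphere M) {L m : ℕ} (h : ∀ k, m ≠ L + 2 * k) :
    ∑ q ∈ degreeSet n m, seriesTerm ν r ζ (Fin.snoc q.1 L : Fin (n + 1) → ℕ) q.2 = 0 := by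
  refine Finset.sum_eq_zero fun q hq => ?_
  rw [← mem_degreeSet.1 hq] at h
  rw [seriesTerm, angV_snoc_eq_zero (q := q) hM ζ h, mul_zero, zero_mul, zero_mul]

/-- The part of total degree `m` of the multiple power series. -/
lemma sum_range_degreeSet_seriesTerm (hM : 1 ≤ M) {n : ℕ} (ν : ℝ) (r : Fin (n + 1) → ℝ)
    (ζ : Fin (n + 1) → USphere M) (m : ℕ) {ρ : ℝ} {η : USphere M}
    (hη : ∑ p, ratio r p • (ζ p.castSucc : Euc M) = ρ • (η : Euc M)) :
    ∑ a ∈ Finset.range (m + 1) ×ˢ degreeSet n m,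
        seriesTerm ν r ζ (Fin.snoc a.2.1 a.1 : Fin (n + 1) → ℕ) a.2.2 =
      gegenExp (gegenParam M) (ν / 2) m (-inner ℝ (ζ (Fin.last n) : Euc M) (η : Euc M)) *
        ρ ^ m := by
  rw [Finset.sum_product, gegenExp, parSum, Finset.sum_mul]
  symm
  refine Finset.sum_of_injOn (fun k => m - 2 * k) ?_ ?_ ?_ ?_
  · intro a ha b hb h
    simp only [Finset.coe_range, Set.mem_Iio] at ha hb
    simp only at h
    omega
  · intro a ha
    simp only [Finset.coe_range, Set.mem_Iio] at ha ⊢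
    omega
  · intro L hL hL'
    refine sum_degreeSet_seriesTerm_eq_zero hM ν r ζ fun k hk => hL' ⟨k, ?_, ?_⟩
    · simp only [Finset.coe_range, Set.mem_Iio]; omega
    · simp only; omega
  · intro k hk
    have hm : m - 2 * k + 2 * k = m := by
      have := Finset.mem_range.1 hk
      omega
    have h := sum_degreeSet_seriesTerm hM ν r ζ (m - 2 * k) k hη
    rw [hm] at h
    exact h.symm

lemma seriesTerm_snoc_eq_zero_of_lt (hM : 1 ≤ M) {n : ℕ} (ν : ℝ) (r : Fin (n + 1) → ℝ)
    (ζ : Fin (n + 1) → USphere M) {L : ℕ} {q : (Fin n → ℕ) × (Fin n → ℕ)}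
    (h : termDegree q < L) : seriesTerm ν r ζ (Fin.snoc q.1 L : Fin (n + 1) → ℕ) q.2 = 0 := by
  rw [seriesTerm, angV_snoc_eq_zero (q := q) hM ζ fun k => by omega, mul_zero, zero_mul, zero_mul]

/-- The multiple power series, with the sums grouped by total degree, is a binomial series. -/
lemma tsum_seriesTerm_snoc (hM : 1 ≤ M) {n : ℕ} (ν : ℝ) (r : Fin (n + 1) → ℝ)
    (ζ : Fin (n + 1) → USphere M) (hx : ∀ p, 0 ≤ ratio r p) (h1 : ∑ p, ratio r p < 1)
    {ρ : ℝ} {η : USphere M} (hρ0 : 0 ≤ ρ) (hρ1 : ρ < 1)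
    (hη : ∑ p, ratio r p • (ζ p.castSucc : Euc M) = ρ • (η : Euc M)) :
    ∑' a : ℕ × ((Fin n → ℕ) × (Fin n → ℕ)),
        seriesTerm ν r ζ (Fin.snoc a.2.1 a.1 : Fin (n + 1) → ℕ) a.2.2 =
      (1 + 2 * inner ℝ (ζ (Fin.last n) : Euc M) (η : Euc M) * ρ + ρ ^ 2) ^ (-(ν / 2)) := by
  have hS := (summable_seriesTerm_snoc hM ν r ζ hx h1).hasSum.tsum_fiberwise
    fun a => termDegree a.2
  have hfib (m : ℕ) : ∑' a : (fun a : ℕ × ((Fin n → ℕ) × (Fin n → ℕ)) =>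
      termDegree a.2) ⁻¹' {m}, seriesTerm ν r ζ (Fin.snoc a.1.2.1 a.1.1 : Fin (n + 1) → ℕ) a.1.2.2 =
      gegenExp (gegenParam M) (ν / 2) m (-inner ℝ (ζ (Fin.last n) : Euc M) (η : Euc M)) *
        ρ ^ m := by
    rw [← sum_range_degreeSet_seriesTerm hM ν r ζ m hη,
      tsum_subtype ((fun a : ℕ × ((Fin n → ℕ) × (Fin n → ℕ)) => termDegree a.2) ⁻¹' {m})
        fun a => seriesTerm ν r ζ (Fin.snoc a.2.1 a.1 : Fin (n + 1) → ℕ) a.2.2,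
      tsum_eq_sum (s := Finset.range (m + 1) ×ˢ degreeSet n m)]
    · refine Finset.sum_congr rfl fun a ha => Set.indicator_of_mem ?_ _
      exact mem_degreeSet.1 (Finset.mem_product.1 ha).2
    · intro a ha
      -- A fibre of the total degree contains every `L`, but the selection rule kills the terms with
      -- `L > m`; the sum over the fibre is therefore finite.
      by_cases hm : termDegree a.2 = m
      · rw [Set.indicator_of_mem (by exact hm)]
        refine seriesTerm_snoc_eq_zero_of_lt hM ν r ζ ?_
        by_contra! h
        exact ha (Finset.mem_product.2 ⟨Finset.mem_range.2 (by omega), mem_degreeSet.2 hm⟩)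
      · exact Set.indicator_of_notMem (by exact hm) _
  simp only [hfib] at hS
  -- The argument `-ζ_N · η` is again an inner product of unit vectors, which gives access to the
  -- bound by the value at `1`.
  have hneg : -inner ℝ (ζ (Fin.last n) : Euc M) (η : Euc M) =
      inner ℝ (ζ (Fin.last n) : Euc M) ((-η : USphere M) : Euc M) := by
    simp [inner_neg_right]
  have ht1 : |-inner ℝ (ζ (Fin.last n) : Euc M) (η : Euc M)| ≤ 1 := by
    rw [abs_neg]
    simpa using abs_real_inner_le_norm (ζ (Fin.last n) : Euc M) (η : Euc M)
  have hG := hasSum_gegenExp (gegenParam_gt hM) (ν / 2) ht1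
    (fun l => by rw [hneg]; exact abs_zonal_inner_le hM l _ _) hρ0 hρ1
  rw [hS.unique hG]
  ring_nf

lemma exists_smul_sphere (ζ : USphere M) (y : Euc M) : ∃ η : USphere M, y = ‖y‖ • (η : Euc M) := by
  by_cases hy : y = 0
  · exact ⟨ζ, by simp [hy]⟩
  · have h0 : ‖y‖ ≠ 0 := norm_ne_zero_iff.2 hy
    refine ⟨⟨‖y‖⁻¹ • y, by simp [norm_smul, h0]⟩, ?_⟩
    simp [smul_smul, h0]

/-- The indices of the multiple power series, with the last angular index singled out. -/
def indexEquiv (n : ℕ) :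
    ℕ × ((Fin n → ℕ) × (Fin n → ℕ)) ≃ (Fin (n + 1) → ℕ) × (Fin n → ℕ) :=
  (Equiv.prodAssoc _ _ _).symm.trans
    ((Fin.snocEquiv fun _ => ℕ).prodCongr (Equiv.refl _))

lemma summable_seriesTerm (hM : 1 ≤ M) {n : ℕ} (ν : ℝ) (r : Fin (n + 1) → ℝ)
    (ζ : Fin (n + 1) → USphere M) (hx : ∀ p, 0 ≤ ratio r p) (h1 : ∑ p, ratio r p < 1) :
    Summable fun q : (Fin (n + 1) → ℕ) × (Fin n → ℕ) => seriesTerm ν r ζ q.1 q.2 :=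
  (indexEquiv n).summable_iff.1 (summable_seriesTerm_snoc hM ν r ζ hx h1)

/-- Pulling out `r_N` leaves `ζ_N + ρ η`, with `ρ < 1` by the triangle inequality. Its squared norm
is the quadratic of the generating function at argument `-ζ_N · η`, so the exponent `-ν` becomes
`-(ν / 2)`. -/
lemma norm_sum_rpow_eq_tsum (hM : 1 ≤ M) {n : ℕ} (ν : ℝ) (r : Fin (n + 1) → ℝ)
    (ζ : Fin (n + 1) → USphere M) (hlast : 0 < r (Fin.last n)) (hx : ∀ p, 0 ≤ ratio r p)
    (h1 : ∑ p, ratio r p < 1) :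
    ‖∑ s, r s • (ζ s : Euc M)‖ ^ (-ν) = r (Fin.last n) ^ (-ν) *
      ∑' q : (Fin (n + 1) → ℕ) × (Fin n → ℕ), seriesTerm ν r ζ q.1 q.2 := by
  set y := ∑ p, ratio r p • (ζ p.castSucc : Euc M) with hy
  obtain ⟨η, hη⟩ := exists_smul_sphere (ζ (Fin.last n)) y
  have hρ : ‖y‖ < 1 := by
    refine (norm_sum_le _ _).trans_lt (lt_of_eq_of_lt ?_ h1)
    refine Finset.sum_congr rfl fun p _ => ?_
    rw [norm_smul, Real.norm_of_nonneg (hx p)]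
    simp
  have hsum : ∑ s, r s • (ζ s : Euc M) = r (Fin.last n) • ((ζ (Fin.last n) : Euc M) + y) := by
    rw [Fin.sum_univ_castSucc, smul_add, hy, Finset.smul_sum, add_comm]
    congr 1
    refine Finset.sum_congr rfl fun p _ => ?_
    rw [smul_smul, ratio, mul_div_cancel₀ _ hlast.ne']
  have hsq : ‖(ζ (Fin.last n) : Euc M) + y‖ ^ 2 =
      1 + 2 * inner ℝ (ζ (Fin.last n) : Euc M) (η : Euc M) * ‖y‖ + ‖y‖ ^ 2 := by
    rw [norm_add_sq_real]
    have : inner ℝ (ζ (Fin.last n) : Euc M) y =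
        ‖y‖ * inner ℝ (ζ (Fin.last n) : Euc M) (η : Euc M) := by
      conv_lhs => rw [hη]
      rw [real_inner_smul_right]
    rw [this]
    simp only [norm_eq_of_mem_sphere]
    ring
  have htsum := (indexEquiv n).tsum_eq
    (fun q : (Fin (n + 1) → ℕ) × (Fin n → ℕ) => seriesTerm ν r ζ q.1 q.2)
  rw [← htsum]
  have := tsum_seriesTerm_snoc hM ν r ζ hx h1 (norm_nonneg y) hρ (hy.symm.trans hη)
  refine Eq.trans ?_ (congrArg (r (Fin.last n) ^ (-ν) * ·) this.symm)
  rw [hsum, norm_smul, Real.norm_of_nonneg hlast.le, Real.mul_rpow hlast.le (norm_nonneg _), ← hsq,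
    ← Real.rpow_natCast, ← Real.rpow_mul (norm_nonneg _)]
  congr 2
  push_cast
  ring

/-! ### The form with Lauricella functions -/

/-- The coefficient of the Lauricella function in the radial function. -/
def radialCoeff {n : ℕ} (M : ℕ) (ν : ℝ) (r : Fin (n + 1) → ℝ) (l : Fin (n + 1) → ℕ) : ℝ :=
  (-1) ^ l (Fin.last n) * r (Fin.last n) ^ (-ν) *
    (pochReal (ν / 2) (halfSum l) *
        pochReal ((ν - M + 2) / 2) (halfSum l - l (Fin.last n)) /
      ∏ p : Fin n, poch ((M : ℝ) / 2) (l p.castSucc)) *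
    ∏ p : Fin n, (r p.castSucc / r (Fin.last n)) ^ l p.castSucc

/-- Splitting `(a)_{i+j} = (a)_i (a+i)_j` isolates the dependence on `μ`. Where `angV` is nonzero
the selection rule makes all Pochhammer indices natural numbers, so the splitting applies; elsewhere
both sides are zero. -/
lemma mul_seriesTerm_eq (hM : 1 ≤ M) {n : ℕ} (ν : ℝ) (r : Fin (n + 1) → ℝ)
    (ζ : Fin (n + 1) → USphere M) (l : Fin (n + 1) → ℕ) (μ : Fin n → ℕ) :
    r (Fin.last n) ^ (-ν) * seriesTerm ν r ζ l μ =
      angV l ζ * radialCoeff M ν r l *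
        lauricellaTerm (paramA ν l) (paramB M ν l) (paramC M l) (argX r) μ := by
  by_cases hV : angV l ζ = 0
  · rw [seriesTerm, hV, mul_zero, zero_mul, zero_mul, mul_zero, zero_mul, zero_mul]
  obtain ⟨⟨a, ha⟩, hL⟩ := angV_selection hM hV
  have hh : halfSum l = a := by
    rw [halfSum, ← Nat.cast_sum, ha]
    push_cast
    ring
  obtain ⟨b, rfl⟩ : ∃ b, a = l (Fin.last n) + b := ⟨a - l (Fin.last n), by omega⟩
  have hb : halfSum l - l (Fin.last n) = b := by rw [hh]; push_cast; ring
  have h1 : pochReal (ν / 2) ((∑ p, (μ p : ℝ)) + halfSum l) =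
      pochReal (ν / 2) (halfSum l) * poch (paramA ν l) (∑ p, μ p) := by
    rw [paramA, hh, pochReal_natCast, add_comm _ (ν / 2), ← poch_add, ← pochReal_natCast]
    push_cast
    ring_nf
  have h2 : pochReal ((ν - M + 2) / 2) ((∑ p, (μ p : ℝ)) + halfSum l - l (Fin.last n)) =
      pochReal ((ν - M + 2) / 2) (halfSum l - l (Fin.last n)) *
        poch (paramB M ν l) (∑ p, μ p) := by
    rw [paramB, add_sub_assoc, add_sub_assoc, hb, pochReal_natCast, ← poch_add,
      ← pochReal_natCast]
    push_cast
    ring_nf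
  have h3 (p : Fin n) : poch ((M : ℝ) / 2) (l p.castSucc + μ p) =
      poch ((M : ℝ) / 2) (l p.castSucc) * poch (paramC M l p) (μ p) := by
    rw [paramC, add_comm (l p.castSucc : ℝ), ← poch_add]
  rw [seriesTerm, radialCoeff, lauricellaTerm, h1, h2]
  simp only [h3]
  simp only [argX, pow_add, pow_mul, Finset.prod_mul_distrib, div_eq_mul_inv, mul_inv]
  ring

lemma summable_lauricellaTerm_param (hM : 1 ≤ M) {n : ℕ} (ν : ℝ) (r : Fin (n + 1) → ℝ)
    (hx : ∀ p, 0 ≤ ratio r p) (h1 : ∑ p, ratio r p < 1) (l : Fin (n + 1) → ℕ) :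
    Summable (lauricellaTerm (paramA ν l) (paramB M ν l) (paramC M l) (argX r)) := by
  refine summable_lauricellaTerm _ _ (fun p => ?_) hx h1
  have : (1 : ℝ) ≤ M := by exact_mod_cast hM
  unfold paramC
  positivity

lemma tsum_seriesTerm_eq (hM : 1 ≤ M) {n : ℕ} (ν : ℝ) (r : Fin (n + 1) → ℝ)
    (ζ : Fin (n + 1) → USphere M) (l : Fin (n + 1) → ℕ) :
    r (Fin.last n) ^ (-ν) * ∑' μ, seriesTerm ν r ζ l μ = angV l ζ * radialR M ν r l := by
  rw [← tsum_mul_left, tsum_congr fun μ => mul_seriesTerm_eq hM ν r ζ l μ, tsum_mul_left,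
    mul_assoc]
  rfl

lemma summable_angV_mul_radialR (hM : 1 ≤ M) {n : ℕ} (ν : ℝ) (r : Fin (n + 1) → ℝ)
    (ζ : Fin (n + 1) → USphere M) (hx : ∀ p, 0 ≤ ratio r p) (h1 : ∑ p, ratio r p < 1) :
    Summable fun l : Fin (n + 1) → ℕ => angV l ζ * radialR M ν r l := by
  simp only [← tsum_seriesTerm_eq hM]
  exact (summable_seriesTerm hM ν r ζ hx h1).prod.mul_left _

lemma tsum_angV_mul_radialR (hM : 1 ≤ M) {n : ℕ} (ν : ℝ) (r : Fin (n + 1) → ℝ)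
    (ζ : Fin (n + 1) → USphere M) (hx : ∀ p, 0 ≤ ratio r p) (h1 : ∑ p, ratio r p < 1) :
    ∑' l : Fin (n + 1) → ℕ, angV l ζ * radialR M ν r l = r (Fin.last n) ^ (-ν) *
      ∑' q : (Fin (n + 1) → ℕ) × (Fin n → ℕ), seriesTerm ν r ζ q.1 q.2 := by
  simp only [← tsum_seriesTerm_eq hM]
  rw [tsum_mul_left, (summable_seriesTerm hM ν r ζ hx h1).tsum_prod]

/-! ### The addition theorem and hyperspherical harmonics -/

/-- The homogeneous harmonic polynomials restrict to hyperspherical harmonics. -/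
lemma IsHarmonic.isSphericalHarmonic {l : ℕ} {p : MvPolynomial (Fin M) ℂ} (hp : IsHarmonic l p) :
    IsSphericalHarmonic M l fun ω => evalAt (ω : Euc M) p :=
  ⟨p, hp.hom, by rw [← lap_apply]; exact hp.lap_eq_zero, fun _ => rfl⟩

lemma IsSphericalHarmonic.exists_isHarmonic {l : ℕ} {f : USphere M → ℂ}
    (hf : IsSphericalHarmonic M l f) :
    ∃ p, IsHarmonic l p ∧ ∀ ω : USphere M, f ω = evalAt (ω : Euc M) p := by
  obtain ⟨p, hp, hl, h⟩ := hf
  exact ⟨p, ⟨hp, by rw [lap_apply]; exact hl⟩, h⟩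

lemma IsSphericalHarmonic.continuous {l : ℕ} {f : USphere M → ℂ}
    (hf : IsSphericalHarmonic M l f) : Continuous f := by
  obtain ⟨p, -, h⟩ := hf.exists_isHarmonic
  rw [funext h]
  exact (continuous_evalAt p).comp continuous_subtype_val

/-- The reproducing property of the zonal harmonics. -/
lemma IsSphericalHarmonic.integral_mul_zonal (hM : 1 ≤ M) {l : ℕ} {f : USphere M → ℂ}
    (hf : IsSphericalHarmonic M l f) (ζ : USphere M) :
    ∫ ω : USphere M, f ω * (zonal (gegenParam M) l (inner ℝ (ζ : Euc M) (ω : Euc M)) : ℂ)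
      ∂(surf M) = sphereArea M * f ζ := by
  obtain ⟨p, hp, h⟩ := hf.exists_isHarmonic
  rw [h, ← sphInt_mul_solidZonal hM hp ζ, sphInt_apply]
  refine integral_congr_ae (.of_forall fun ω => ?_)
  simp only [h, evalAt_mul, evalAt_solidZonal]

/-- The addition theorem for hyperspherical harmonics. -/
lemma IsHarmonicBasis.zonal_eq (hM : 1 ≤ M) {l d : ℕ} {Y : Fin d → USphere M → ℂ}
    (hY : IsHarmonicBasis M l Y) (ζ ω : USphere M) :
    (zonal (gegenParam M) l (inner ℝ (ζ : Euc M) (ω : Euc M)) : ℂ) =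
      sphereArea M * ∑ m, Y m ζ * (starRingEnd ℂ) (Y m ω) := by
  have hcont (m) := (hY.mem m).continuous
  have hz : IsSphericalHarmonic M l fun ω =>
      ((zonal (gegenParam M) l (inner ℝ (ζ : Euc M) (ω : Euc M)) : ℝ) : ℂ) := by
    have := (isHarmonic_solidZonal hM (sum_cvec_sq_sphere ζ) l).isSphericalHarmonic
    simpa only [evalAt_solidZonal] using this
  obtain ⟨c, hc⟩ := (Submodule.mem_span_range_iff_exists_fun ℂ).1 (hY.span _ hz)
  have hc' (ω : USphere M) : (zonal (gegenParam M) l (inner ℝ (ζ : Euc M) (ω : Euc M)) : ℂ) =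
      ∑ m, c m * Y m ω := by
    have := congrFun hc ω
    simpa using this.symm
  -- The coefficients of the zonal harmonic in the basis are found by evaluating its integral
  -- against `Y m` both by the reproducing property and by orthonormality; the zonal harmonic is
  -- real, so it may be replaced by its conjugate.
  have hcoeff (m : Fin d) : (starRingEnd ℂ) (c m) = sphereArea M * Y m ζ := by
    rw [← (hY.mem m).integral_mul_zonal hM ζ]
    have hconj (ω : USphere M) : Y m ω *
        (zonal (gegenParam M) l (inner ℝ (ζ : Euc M) (ω : Euc M)) : ℂ) =
        ∑ m', (starRingEnd ℂ) (c m') * (Y m ω * (starRingEnd ℂ) (Y m' ω)) := by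
      rw [← Complex.conj_ofReal, hc', map_sum, Finset.mul_sum]
      refine Finset.sum_congr rfl fun m' _ => ?_
      rw [map_mul]
      ring
    simp only [hconj]
    rw [integral_finsetSum]
    · simp only [integral_const_mul, hY.orthonormal]
      simp
    · intro m' _
      exact integrable_sphere (continuous_const.mul
        ((hcont m).mul (Complex.continuous_conj.comp (hcont m'))))
  rw [← Complex.conj_ofReal, hc', map_sum, Finset.mul_sum]
  refine Finset.sum_congr rfl fun m _ => ?_
  rw [map_mul, hcoeff]
  ring

/-- The addition theorem is inserted in each of the `n + 1` factors and the product of sums is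
expanded; the normalization by the sphere area leaves the power `n`. -/
lemma angV_eq_sum_harmonics (hM : 1 ≤ M) {n : ℕ} {d : ℕ → ℕ}
    {Y : (k : ℕ) → Fin (d k) → USphere M → ℂ} (hY : ∀ k, IsHarmonicBasis M k (Y k))
    (l : Fin (n + 1) → ℕ) (ζ : Fin (n + 1) → USphere M) :
    ((angV l ζ : ℝ) : ℂ) = (sphereArea M : ℂ) ^ n *
      ∑ m : (p : Fin (n + 1)) → Fin (d (l p)), (∏ p, Y (l p) (m p) (ζ p)) *
        ∫ ω, ∏ p, (starRingEnd ℂ) (Y (l p) (m p) ω) ∂(surf M) := by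
  have hS : (sphereArea M : ℂ) ≠ 0 := by exact_mod_cast (sphereArea_pos hM).ne'
  have hprod (ω : USphere M) :
      ((∏ i, normGegenbauer M (l i) (inner ℝ (ζ i : Euc M) (ω : Euc M)) : ℝ) : ℂ) =
      (sphereArea M : ℂ) ^ (n + 1) * ∑ m : (p : Fin (n + 1)) → Fin (d (l p)),
        (∏ p, Y (l p) (m p) (ζ p)) * ∏ p, (starRingEnd ℂ) (Y (l p) (m p) ω) := by
    rw [Complex.ofReal_prod]
    simp only [normGegenbauer_eq_zonal hM]
    rw [Finset.prod_congr rfl fun p _ => (hY (l p)).zonal_eq hM (ζ p) ω, Finset.prod_mul_distrib,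
      Finset.prod_const, Finset.card_univ, Fintype.card_fin, Finset.prod_univ_sum,
      Fintype.piFinset_univ]
    simp only [Finset.prod_mul_distrib]
  rw [angV, Complex.ofReal_div, ← integral_complex_ofReal]
  simp only [hprod]
  rw [integral_const_mul, integral_finsetSum]
  · simp only [integral_const_mul]
    rw [pow_succ]
    field_simp
  · intro m _
    exact integrable_sphere (continuous_const.mul (continuous_finsetProd _ fun p _ =>
      Complex.continuous_conj.comp ((hY (l p)).mem (m p)).continuous))

end

end Hyperspherical

theorem theorem1 (M : ℕ) (hM : 1 ≤ M) (n : ℕ) (ν : ℝ)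
    (r : Fin (n + 1) → ℝ) (ζ : Fin (n + 1) → Hyperspherical.USphere M)
    (hr : ∀ s, 0 ≤ r s) (hlast : 0 < r (Fin.last n))
    (hconv : ∑ p : Fin n, r p.castSucc / r (Fin.last n) < 1) :
    -- the multiple power series converges absolutely and has the asserted sum
    (Summable (fun q : (Fin (n + 1) → ℕ) × (Fin n → ℕ) =>
        Hyperspherical.seriesTerm ν r ζ q.1 q.2) ∧
      ‖∑ s, r s • (ζ s : Hyperspherical.Euc M)‖ ^ (-ν) =
        r (Fin.last n) ^ (-ν) *
          ∑' q : (Fin (n + 1) → ℕ) × (Fin n → ℕ), Hyperspherical.seriesTerm ν r ζ q.1 q.2) ∧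
    -- the angular function vanishes unless both Pochhammer indices are natural numbers
    (∀ l : Fin (n + 1) → ℕ, Hyperspherical.angV l ζ ≠ 0 →
      Even (∑ p, l p) ∧ 2 * l (Fin.last n) ≤ ∑ p, l p) ∧
    -- the angular function through hyperspherical harmonics
    (∀ (d : ℕ → ℕ) (Y : (k : ℕ) → Fin (d k) → Hyperspherical.USphere M → ℂ),
      (∀ k, Hyperspherical.IsHarmonicBasis M k (Y k)) →
      ∀ l : Fin (n + 1) → ℕ,
        ((Hyperspherical.angV l ζ : ℝ) : ℂ) =
          (Hyperspherical.sphereArea M : ℂ) ^ n *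
            ∑ m : (p : Fin (n + 1)) → Fin (d (l p)),
              (∏ p, Y (l p) (m p) (ζ p)) *
                ∫ ω, ∏ p, (starRingEnd ℂ) (Y (l p) (m p) ω) ∂(Hyperspherical.surf M)) ∧
    -- the form with Lauricella functions
    ((∀ l : Fin (n + 1) → ℕ, Summable (Hyperspherical.lauricellaTerm
        (Hyperspherical.paramA ν l) (Hyperspherical.paramB M ν l)
        (Hyperspherical.paramC M l) (Hyperspherical.argX r))) ∧
      Summable (fun l : Fin (n + 1) → ℕ =>
        Hyperspherical.angV l ζ * Hyperspherical.radialR M ν r l) ∧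
      ‖∑ s, r s • (ζ s : Hyperspherical.Euc M)‖ ^ (-ν) =
        ∑' l : Fin (n + 1) → ℕ, Hyperspherical.angV l ζ * Hyperspherical.radialR M ν r l) := by
  have hx : ∀ p, 0 ≤ Hyperspherical.ratio r p := fun p => div_nonneg (hr _) hlast.le
  refine ⟨⟨Hyperspherical.summable_seriesTerm hM ν r ζ hx hconv,
    Hyperspherical.norm_sum_rpow_eq_tsum hM ν r ζ hlast hx hconv⟩,
    fun l => Hyperspherical.angV_selection hM,
    fun d Y hY l => Hyperspherical.angV_eq_sum_harmonics hM hY l ζ,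
    Hyperspherical.summable_lauricellaTerm_param hM ν r hx hconv,
    Hyperspherical.summable_angV_mul_radialR hM ν r ζ hx hconv, ?_⟩
  rw [Hyperspherical.tsum_angV_mul_radialR hM ν r ζ hx hconv,
    Hyperspherical.norm_sum_rpow_eq_tsum hM ν r ζ hlast hx hconv]
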